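/- Let $k\ge 2$ be an integer, $\alpha\ge 0$, $\theta\in[0,1]$ and $\ell\ge 0$ an integer. Random tree formula. A $k$-SAT formula has variables $x_i\in\{0,1\}$ and clauses $a$; each clause depends on $k$ variables, and for each variable $i$ of $a$ there is a value $z_i(a)\in\{0,1\}$ that violates $a$. An assignment is a solution if in every clause at least one variable does not take its violating value. The random rooted tree formula $\mathsf T(\ell)$ is defined recursively. $\mathsf T(0)$ consists of a single variable, the root. For $\ell\ge1$, start from the root, add a $\mathrm{Poisson}(\alpha k)$-distributed number of clauses, each containing the root and $k-1$ new variables, and attach to each of these new variables an independent copy of $\mathsf T(\ell-1)$. All violating values are independent and uniform in $\{0,1\}$. Frozen variables. Given a set $U$ of variables and values $x^*_U$, unit clause propagation assigns $x_i^*$ to each $i\in U$, and repeatedly, whenever all variables of a clause except one have been assigned their violating values, assigns to the remaining variable the value that satisfies the clause. A variable $i\notin U$ is directly implied by $x^*_U$ if it is assigned a value in this way, and a variable is frozen if it is in $U$ or directly implied. Statement. Given $\mathsf T(\ell)$, let $U$ contain each variable of $\mathsf T(\ell)$ independently with probability $\theta$, and let $x^*$ be a uniformly random solution of $\mathsf T(\ell)$,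 independent of $U$. Then the probability that the root of $\mathsf T(\ell)$ is frozen equals $$\phi^{\rm tree}_\ell(\theta)=\mathbb E_\ell\big[(1-\tanh h)\,\widehat h\big],$$ where the integrand is integrable and $\mathbb E_\ell$ denotes expectation with respect to the law of the random vector $(h,\widehat h)_\ell$ in $\mathbb R^2$ defined by the recursion, for $\ell\ge 0$, $$(h,\widehat h)_\ell\stackrel{\rm d}{=}\Big(\sum_{i=1}^{l_+}u_i^+-\sum_{i=1}^{l_-}u_i^-,\ 1-\zeta\prod_{i=1}^{l_-}(1-\widehat u_i^-)\Big),$$ $$(u,\widehat u)_{\ell+1}\stackrel{\rm d}{=}\Big(f(h_1,\dots,h_{k-1}),\ \prod_{i=1}^{k-1}\frac{1-\tanh h_i}{2}\,\widehat h_i\Big),$$ with $(u,\widehat u)_0=(0,0)$ almost surely and $$f(h_1,\dots,h_{k-1})=-\frac12\log\Big\{1-\frac1{2^{k-1}}\prod_{i=1}^{k-1}(1-\tanh h_i)\Big\}.$$ Here $l_+$ and $l_-$ are Poisson random variables of parameter $\alpha k/2$, $\zeta$ equals $0$ with probability $\theta$ and $1$ with probability $1-\theta$, the $(u_i^\pm,\widehat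 u_i^\pm)$ are copies of $(u,\widehat u)_\ell$, the $(h_i,\widehat h_i)$ are copies of $(h,\widehat h)_\ell$, and all random variables entering the right-hand side of each equation are independent. -/

import Mathlib

open MeasureTheory ProbabilityTheory
open scoped NNReal ENNReal

namespace KSatTree

/-! ### Formulas, solutions, unit clause propagation -/

/-- A `k`-SAT formula with variables `V` and clauses `C`. Clause `a` depends on the variables
`var a 0, …, var a (k - 1)`, and `z a p` is the value of `var a p` which does not satisfy `a`. -/
structure Formula (k : ℕ) (V C : Type) where
  var : C → Fin k → V
  z : C → Fin k → Bool

namespace Formula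

variable {k : ℕ} {V C : Type} (F : Formula k V C)

/-- Every clause contains a variable that does not take its violating value. -/
def IsSolution (x : V → Bool) : Prop :=
  ∀ a, ∃ p, x (F.var a p) ≠ F.z a p

/-- `F.Derived U x i b`: the variable `i` gets the value `b` in unit clause propagation started
from the values `x i`, `i ∈ U` (the values of `x` outside `U` are not used). In the rule `unit` all
variables of the clause `a`, except the one at position `p`, already have their violating value,
so `a` has been reduced to a unit clause on the variable at `p`, which has to satisfy it. -/
inductive Derived (U : Finset V) (x : V → Bool) : V → Bool → Prop
  | fixed (i : V) (hi : i ∈ U) : Derived U x i (x i)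
  | unit (a : C) (p : Fin k) (h : ∀ q, q ≠ p → Derived U x (F.var a q) (F.z a q)) :
      Derived U x (F.var a p) (!F.z a p)

/-- `i` is not fixed, but gets a value by unit clause propagation. -/
def DirectlyImplied (U : Finset V) (x : V → Bool) (i : V) : Prop :=
  i ∉ U ∧ ∃ b, F.Derived U x i b

/-- Fixed or directly implied. -/
def Frozen (U : Finset V) (x : V → Bool) (i : V) : Prop :=
  i ∈ U ∨ F.DirectlyImplied U x i

open Classical in
/-- The uniform distribution over the solutions of a satisfiable formula. -/
noncomputable def uniformSolution [Fintype V] (hF : ∃ x, F.IsSolution x) : PMF (V → Bool) :=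
  PMF.uniformOfFinset (Finset.univ.filter F.IsSolution)
    (hF.imp fun _ hx => Finset.mem_filter.2 ⟨Finset.mem_univ _, hx⟩)

end Formula

/-! ### Rooted tree formulas -/

/-- Finite rooted trees: `n` clauses contain the root. Clause `a : Fin n` contains the root at
position `0` and the root of the subtree `child a j` at position `j + 1`; the violating value at
position `p` is `z a p`. -/
inductive Tree (k : ℕ) : Type
  | node (n : ℕ) (z : Fin n → Fin k → Bool) (child : Fin n → Fin (k - 1) → Tree k) : Tree k

namespace Tree

variable {k : ℕ}

/-- Variable nodes: `none` is the root, the others are the variable nodes of the subtrees. -/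
def Var : Tree k → Type
  | node n _ child => Option (Σ a : Fin n, Σ j : Fin (k - 1), (child a j).Var)

/-- Clause nodes: those that contain the root, and the clause nodes of the subtrees. -/
def Clause : Tree k → Type
  | node n _ child => Fin n ⊕ (Σ a : Fin n, Σ j : Fin (k - 1), (child a j).Clause)

/-- The root variable node. -/
def root : (T : Tree k) → T.Var
  | node n _ child => (none : Option (Σ a : Fin n, Σ j : Fin (k - 1), (child a j).Var))

@[reducible] def fintypeVar : (T : Tree k) → Fintype T.Var
  | node n _ child =>
    haveI : ∀ (a : Fin n) (j : Fin (k - 1)), Fintype (child a j).Var :=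
      fun a j => fintypeVar (child a j)
    inferInstanceAs (Fintype (Option (Σ a : Fin n, Σ j : Fin (k - 1), (child a j).Var)))

instance (T : Tree k) : Fintype T.Var := fintypeVar T

/-- The variable at position `p` of a clause. -/
def varAt : (T : Tree k) → T.Clause → Fin k → T.Var
  | node _ _ child, .inl a, p =>
    if hp : p.val = 0 then none
    else
      have hlt : p.val - 1 < k - 1 := by omega
      some ⟨a, ⟨p.val - 1, hlt⟩, (child a ⟨p.val - 1, hlt⟩).root⟩
  | node _ _ child, .inr ⟨a, j, c⟩, p => some ⟨a, j, (child a j).varAt c p⟩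

/-- The violating value at position `p` of a clause. -/
def zAt : (T : Tree k) → T.Clause → Fin k → Bool
  | node _ z _, .inl a, p => z a p
  | node _ _ child, .inr ⟨a, j, c⟩, p => (child a j).zAt c p

/-- The `k`-SAT formula of a tree. -/
def formula (T : Tree k) : Formula k T.Var T.Clause := ⟨T.varAt, T.zAt⟩

theorem exists_isSolution_root (hk : 2 ≤ k) (T : Tree k) :
    ∀ b : Bool, ∃ x, T.formula.IsSolution x ∧ x T.root = b := by
  induction T with
  | node n z child ih =>
    intro b
    have h1 : 1 < k := hk
    choose y hy hr using fun a j => ih a j (!z a ⟨1, h1⟩)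
    refine ⟨fun v : Option _ => v.elim b fun w => y w.1 w.2.1 w.2.2, ?_, rfl⟩
    rintro (a | ⟨a, j, c⟩)
    · refine ⟨⟨1, h1⟩, ?_⟩
      have h := hr a ⟨0, by omega⟩
      simp only [formula, varAt, zAt]
      simp [h]
    · obtain ⟨p, hp⟩ := hy a j c
      exact ⟨p, hp⟩

theorem exists_isSolution (hk : 2 ≤ k) (T : Tree k) : ∃ x, T.formula.IsSolution x :=
  (exists_isSolution_root hk T false).imp fun _ h => h.1

end Tree

/-! ### The random experiment -/

/-- `n` independent copies. -/
noncomputable def iid {A : Type} (μ : PMF A) : (n : ℕ) → PMF (Fin n → A)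
  | 0 => PMF.pure Fin.elim0
  | n + 1 => μ.bind fun a => (iid μ n).map fun s => Fin.cons a s

/-- The Poisson distribution of parameter `r`. -/
noncomputable def poisson (r : ℝ≥0) : PMF ℕ := (poissonMeasure r).toPMF

/-- The random tree formula of depth `ℓ`: `Poisson(α k)` clauses contain the root, the violating
values are fair coins, and independent copies for depth `ℓ - 1` are attached to the first generation
variables. -/
noncomputable def treeLaw (k : ℕ) (α : ℝ≥0) : ℕ → PMF (Tree k)
  | 0 => PMF.pure (Tree.node 0 Fin.elim0 Fin.elim0)
  | ℓ + 1 =>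
    (poisson (α * k)).bind fun n =>
      (iid (PMF.uniformOfFintype (Fin k → Bool)) n).bind fun z =>
        (iid (iid (treeLaw k α ℓ) (k - 1)) n).bind fun child =>
          PMF.pure (Tree.node n z child)

/-- The random subset that contains each element of `V` independently with probability `θ`. -/
noncomputable def subsetLaw (θ : ℝ≥0) (hθ : θ ≤ 1) (V : Type) [Fintype V] : PMF (Finset V) :=
  PMF.ofFintype
    (fun U => (θ : ℝ≥0∞) ^ U.card * (1 - (θ : ℝ≥0∞)) ^ (Fintype.card V - U.card)) (by
      rw [Fintype.sum_pow_mul_eq_add_pow, add_tsub_cancel_of_le (by exact_mod_cast hθ), one_pow])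

/-- The joint law of the random tree `T` of depth `ℓ`, the set `U` of fixed variables, and the
uniformly random solution; given `T`, the last two are independent. -/
noncomputable def experiment (k : ℕ) (hk : 2 ≤ k) (α θ : ℝ≥0) (hθ : θ ≤ 1) (ℓ : ℕ) :
    PMF (Σ T : Tree k, Finset T.Var × (T.Var → Bool)) :=
  (treeLaw k α ℓ).bind fun T =>
    (subsetLaw θ hθ T.Var).bind fun U =>
      (T.formula.uniformSolution (T.exists_isSolution hk)).bind fun x =>
        PMF.pure ⟨T, U, x⟩

/-- The event that the root is frozen. -/
def rootFrozen (k : ℕ) : Set (Σ T : Tree k, Finset T.Var × (T.Var → Bool)) :=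
  {ω | ω.1.formula.Frozen ω.2.1 ω.2.2 ω.1.root}

/-! ### The distributional recursion -/

/-- The belief propagation function `f(h₁, …, h_m)`. -/
noncomputable def bpFun {m : ℕ} (h : Fin m → ℝ) : ℝ :=
  -(1 / 2) * Real.log (1 - 1 / 2 ^ m * ∏ i, (1 - Real.tanh (h i)))

/-- The variable `ζ`: `0` with probability `θ` and `1` with probability `1 - θ`. -/
noncomputable def zetaLaw (θ : ℝ≥0) (hθ : θ ≤ 1) : PMF ℝ :=
  (PMF.ofFintype (fun b : Bool => cond b (θ : ℝ≥0∞) (1 - (θ : ℝ≥0∞))) (by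
      rw [Fintype.sum_bool, cond_true, cond_false]
      exact add_tsub_cancel_of_le (ENNReal.coe_le_one_iff.2 hθ))).bind
    fun b => PMF.pure (cond b 0 1)

/-- The law of `(h, ĥ)` obtained from the law `μ` of `(u, û)`. -/
noncomputable def hStep (k : ℕ) (α θ : ℝ≥0) (hθ : θ ≤ 1) (μ : PMF (ℝ × ℝ)) : PMF (ℝ × ℝ) :=
  (poisson (α * k / 2)).bind fun lp =>
    (poisson (α * k / 2)).bind fun lm =>
      (zetaLaw θ hθ).bind fun ζ =>
        (iid μ lp).bind fun up =>
          (iid μ lm).bind fun um =>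
            PMF.pure ((∑ i, (up i).1) - (∑ i, (um i).1), 1 - ζ * ∏ i, (1 - (um i).2))

/-- The law of `(u, û)` obtained from the law `ν` of `(h, ĥ)`. -/
noncomputable def uStep (k : ℕ) (ν : PMF (ℝ × ℝ)) : PMF (ℝ × ℝ) :=
  (iid ν (k - 1)).bind fun h =>
    PMF.pure (bpFun (fun i => (h i).1), ∏ i, ((1 - Real.tanh (h i).1) / 2 * (h i).2))

/-- The law of `(u, û)_ℓ`. -/
noncomputable def uLaw (k : ℕ) (α θ : ℝ≥0) (hθ : θ ≤ 1) : ℕ → PMF (ℝ × ℝ)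
  | 0 => PMF.pure (0, 0)
  | ℓ + 1 => uStep k (hStep k α θ hθ (uLaw k α θ hθ ℓ))

/-- The law of `(h, ĥ)_ℓ`. -/
noncomputable def hLaw (k : ℕ) (α θ : ℝ≥0) (hθ : θ ≤ 1) (ℓ : ℕ) : PMF (ℝ × ℝ) :=
  hStep k α θ hθ (uLaw k α θ hθ ℓ)

end KSatTree

/-! Fix a tree and a value `b` of its root. Given the root, the subtrees below different root
clauses do not interact, so the number of solutions with root value `b`, and the weighted number of
those whose root is not frozen, factor over the root clauses. A clause that `b` violates only
forbids all its other variables to be violating; this is `u`, and it favours `!b`. A clause that `b`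
satisfies leaves its subtrees free, and it implies the root exactly when all its other variables are
violating and frozen inside their own subtrees; the probability of this is `û`. Nothing flows back
into such a subtree: the clause above could only give the child its satisfying value, while
propagation from a solution reproduces that solution (`derived_of_derived_lift`). Hence the pair
`message`, made of half the log ratio of the two counts and of the conditional frozen probability,
satisfies a deterministic recursion on the tree (`message_spec`), and the root is frozen with
probability `∑ b, (1 - tanh h_b) / 2 * ĥ_b` (`sum_message`).

For a random tree, Poisson thinning splits the root clauses into two independent Poisson families,
so the law of the message does not depend on `b` (`treeLaw_map_message`). The two values of `b`
contribute equally, which cancels the factor `1/2`.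

One mismatch remains: the message of a tree is averaged over `U`, so it contains the mean `1 - θ` in
place of the random `ζ`. The joint laws need not agree, but the target is linear in `ĥ`, so the law
of `h` and the conditional mean of `ĥ` given `h` are enough. The recursion preserves this weaker
agreement `MeanEq`, because independent copies of `1 - û`, of `ĥ` and of `ζ` enter it through
products (`meanEq_hLaw`). -/

namespace KSatTree

/-! ### Expectations with respect to discrete laws -/

/-- The expectation of a nonnegative function. -/
noncomputable def expect {A : Type} (p : PMF A) (f : A → ℝ≥0∞) : ℝ≥0∞ := ∑' a, p a * f a

section Expect

variable {A B C : Type}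

theorem expect_pure (a : A) (f : A → ℝ≥0∞) : expect (PMF.pure a) f = f a := by
  rw [expect, tsum_eq_single a]
  · simp
  · intro b hb
    simp [hb]

theorem expect_bind (p : PMF A) (q : A → PMF B) (f : B → ℝ≥0∞) :
    expect (p.bind q) f = expect p fun a => expect (q a) f := by
  simp only [expect, PMF.bind_apply, ← ENNReal.tsum_mul_right, ← ENNReal.tsum_mul_left]
  rw [ENNReal.tsum_comm]
  simp only [mul_assoc]

theorem expect_map (p : PMF A) (g : A → B) (f : B → ℝ≥0∞) :
    expect (p.map g) f = expect p fun a => f (g a) := by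
  rw [← PMF.bind_pure_comp, expect_bind]
  simp only [Function.comp, expect_pure]

theorem expect_const (p : PMF A) (c : ℝ≥0∞) : (expect p fun _ => c) = c := by
  rw [expect, ENNReal.tsum_mul_right, p.tsum_coe, one_mul]

theorem expect_mul_const (p : PMF A) (f : A → ℝ≥0∞) (c : ℝ≥0∞) :
    (expect p fun a => f a * c) = expect p f * c := by
  simp only [expect, ← ENNReal.tsum_mul_right, mul_assoc]

theorem expect_const_mul (p : PMF A) (f : A → ℝ≥0∞) (c : ℝ≥0∞) :
    (expect p fun a => c * f a) = c * expect p f := by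
  simp only [mul_comm c, expect_mul_const]

theorem expect_add (p : PMF A) (f g : A → ℝ≥0∞) :
    (expect p fun a => f a + g a) = expect p f + expect p g := by
  simp only [expect, mul_add, ENNReal.tsum_add]

theorem expect_congr {p : PMF A} {f g : A → ℝ≥0∞} (h : ∀ a ∈ p.support, f a = g a) :
    expect p f = expect p g := by
  refine tsum_congr fun a => ?_
  by_cases ha : a ∈ p.support
  · rw [h a ha]
  · rw [(p.apply_eq_zero_iff a).2 ha, zero_mul, zero_mul]

theorem expect_comm (p : PMF A) (q : PMF B) (f : A → B → ℝ≥0∞) :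
    (expect p fun a => expect q fun b => f a b) = expect q fun b => expect p fun a => f a b := by
  simp only [expect, ← ENNReal.tsum_mul_left]
  rw [ENNReal.tsum_comm]
  refine tsum_congr fun b => tsum_congr fun a => ?_
  ring

theorem expect_le_one {p : PMF A} {f : A → ℝ≥0∞} (h : ∀ a, f a ≤ 1) : expect p f ≤ 1 := by
  rw [← expect_const p 1]
  exact ENNReal.tsum_le_tsum fun a => mul_le_mul_right (h a) _

/-! ### Independent copies -/

theorem map_eq_bind (p : PMF A) (f : A → B) : p.map f = p.bind fun a => PMF.pure (f a) := rfl

theorem iid_succ (μ : PMF A) (n : ℕ) :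
    iid μ (n + 1) = μ.bind fun a => (iid μ n).bind fun s => PMF.pure (Fin.cons a s) := rfl

theorem iid_zero (μ : PMF A) : iid μ 0 = PMF.pure Fin.elim0 := rfl

theorem mem_support_of_mem_support_iid {μ : PMF A} :
    ∀ {n : ℕ} {s : Fin n → A}, s ∈ (iid μ n).support → ∀ i, s i ∈ μ.support
  | 0, _, _, i => i.elim0
  | n + 1, s, hs, i => by
    rw [iid_succ] at hs
    obtain ⟨a, ha, hs⟩ := (PMF.mem_support_bind_iff _ _ _).1 hs
    obtain ⟨t, ht, hs⟩ := (PMF.mem_support_bind_iff _ _ _).1 hs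
    rw [PMF.mem_support_pure_iff] at hs
    subst hs
    refine Fin.cases ?_ (fun i => ?_) i
    · simpa using ha
    · simpa using mem_support_of_mem_support_iid ht i

/-- The map may vary with the coordinate: the message of each child is taken at its own violating
value, and only the law of the result is common. -/
theorem map_iid {μ : PMF A} {ν : PMF B} :
    ∀ {n : ℕ} (f : Fin n → A → B), (∀ i, μ.map (f i) = ν) →
      (iid μ n).map (fun s i => f i (s i)) = iid ν n
  | 0, f, _ => by
    rw [iid_zero, iid_zero, PMF.pure_map]
    congr 1
    funext i
    exact i.elim0
  | n + 1, f, h => by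
    have hn := map_iid (fun i : Fin n => f i.succ) fun i => h i.succ
    rw [iid_succ, iid_succ, ← hn]
    conv_rhs => rw [← h 0]
    simp only [map_eq_bind, PMF.bind_bind, PMF.pure_bind]
    congr 1; funext a; congr 1; funext s; congr 1; funext i
    refine Fin.cases ?_ (fun i => ?_) i <;> simp

/-- `treeLaw` draws all violating values before all subtrees; this regroups the draws clause by
clause. -/
theorem iid_bind_iid (μ : PMF A) (ν : PMF B) (f : A → B → C) :
    ∀ n : ℕ, ((iid μ n).bind fun s => (iid ν n).bind fun t => PMF.pure fun i => f (s i) (t i)) =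
      iid (μ.bind fun a => ν.bind fun b => PMF.pure (f a b)) n
  | 0 => by
    simp only [iid_zero, PMF.pure_bind]
    congr 1
    funext i
    exact i.elim0
  | n + 1 => by
    have hn := iid_bind_iid μ ν f n
    rw [iid_succ, iid_succ, iid_succ, ← hn]
    simp only [PMF.bind_bind, PMF.pure_bind]
    congr 1; funext a
    rw [PMF.bind_comm]
    congr 1; funext b; congr 1; funext s; congr 1; funext t; congr 1; funext i
    refine Fin.cases ?_ (fun i => ?_) i <;> simp

theorem iid_pure (a : A) : ∀ n : ℕ, iid (PMF.pure a) n = PMF.pure fun _ => a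
  | 0 => by
    rw [iid_zero]
    congr 1
    funext i
    exact i.elim0
  | n + 1 => by
    rw [iid_succ, iid_pure a n, PMF.pure_bind, PMF.pure_bind]
    congr 1
    funext i
    refine Fin.cases ?_ (fun i => ?_) i <;> simp

end Expect

/-! ### Weighted marginals of the distributional recursion -/

/-- The recursion step `hStep` with an arbitrary law for the variable `ζ`. -/
noncomputable def hStepOf (k : ℕ) (α : ℝ≥0) (Z : PMF ℝ) (μ : PMF (ℝ × ℝ)) : PMF (ℝ × ℝ) :=
  (poisson (α * k / 2)).bind fun lp =>
    (poisson (α * k / 2)).bind fun lm =>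
      Z.bind fun ζ =>
        (iid μ lp).bind fun up =>
          (iid μ lm).bind fun um =>
            PMF.pure ((∑ i, (up i).1) - (∑ i, (um i).1), 1 - ζ * ∏ i, (1 - (um i).2))

/-- The law of `(u, û)` in the recursion with an arbitrary law for the variable `ζ`. -/
noncomputable def uLawOf (k : ℕ) (α : ℝ≥0) (Z : PMF ℝ) : ℕ → PMF (ℝ × ℝ)
  | 0 => PMF.pure (0, 0)
  | ℓ + 1 => uStep k (hStepOf k α Z (uLawOf k α Z ℓ))

/-- The law of `(h, ĥ)` in the recursion with an arbitrary law for the variable `ζ`. -/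
noncomputable def hLawOf (k : ℕ) (α : ℝ≥0) (Z : PMF ℝ) (ℓ : ℕ) : PMF (ℝ × ℝ) :=
  hStepOf k α Z (uLawOf k α Z ℓ)

theorem uLaw_eq_uLawOf (k : ℕ) (α θ : ℝ≥0) (hθ : θ ≤ 1) :
    ∀ ℓ, uLaw k α θ hθ ℓ = uLawOf k α (zetaLaw θ hθ) ℓ
  | 0 => rfl
  | ℓ + 1 => by
    rw [uLaw, uLawOf, uLaw_eq_uLawOf k α θ hθ ℓ]
    rfl

theorem hLaw_eq_hLawOf (k : ℕ) (α θ : ℝ≥0) (hθ : θ ≤ 1) (ℓ : ℕ) :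
    hLaw k α θ hθ ℓ = hLawOf k α (zetaLaw θ hθ) ℓ := by
  rw [hLaw, hLawOf, uLaw_eq_uLawOf]
  rfl

/-! ### Range of the second component -/

/-- The second component takes values in `[0, 1]`. -/
def SndInUnit (μ : PMF (ℝ × ℝ)) : Prop := ∀ p ∈ μ.support, p.2 ∈ Set.Icc (0 : ℝ) 1

theorem prod_mem_Icc {n : ℕ} {f : Fin n → ℝ} (h : ∀ i, f i ∈ Set.Icc (0 : ℝ) 1) :
    ∏ i, f i ∈ Set.Icc (0 : ℝ) 1 :=
  ⟨Finset.prod_nonneg fun i _ => (h i).1, Finset.prod_le_one (fun i _ => (h i).1) fun i _ => (h i).2⟩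

theorem half_one_sub_tanh_mem_Icc (x : ℝ) : (1 - Real.tanh x) / 2 ∈ Set.Icc (0 : ℝ) 1 := by
  have h1 := Real.tanh_lt_one x
  have h2 := Real.neg_one_lt_tanh x
  constructor <;> linarith

theorem one_sub_mem_Icc {x : ℝ} (h : x ∈ Set.Icc (0 : ℝ) 1) : 1 - x ∈ Set.Icc (0 : ℝ) 1 :=
  ⟨by linarith [h.2], by linarith [h.1]⟩

theorem mul_mem_Icc {x y : ℝ} (hx : x ∈ Set.Icc (0 : ℝ) 1) (hy : y ∈ Set.Icc (0 : ℝ) 1) :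
    x * y ∈ Set.Icc (0 : ℝ) 1 :=
  ⟨mul_nonneg hx.1 hy.1, mul_le_one₀ hx.2 hy.1 hy.2⟩

theorem SndInUnit.uStep {k : ℕ} {ν : PMF (ℝ × ℝ)} (h : SndInUnit ν) : SndInUnit (uStep k ν) := by
  intro p hp
  rw [KSatTree.uStep] at hp
  obtain ⟨s, hs, hp⟩ := (PMF.mem_support_bind_iff _ _ _).1 hp
  rw [PMF.mem_support_pure_iff] at hp
  subst hp
  exact prod_mem_Icc fun i => mul_mem_Icc (half_one_sub_tanh_mem_Icc _)
    (h _ (mem_support_of_mem_support_iid hs i))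

theorem SndInUnit.hStepOf {k : ℕ} {α : ℝ≥0} {Z : PMF ℝ} {μ : PMF (ℝ × ℝ)}
    (hZ : ∀ ζ ∈ Z.support, ζ ∈ Set.Icc (0 : ℝ) 1) (h : SndInUnit μ) :
    SndInUnit (hStepOf k α Z μ) := by
  intro p hp
  rw [KSatTree.hStepOf] at hp
  obtain ⟨lp, -, hp⟩ := (PMF.mem_support_bind_iff _ _ _).1 hp
  obtain ⟨lm, -, hp⟩ := (PMF.mem_support_bind_iff _ _ _).1 hp
  obtain ⟨ζ, hζ, hp⟩ := (PMF.mem_support_bind_iff _ _ _).1 hp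
  obtain ⟨up, -, hp⟩ := (PMF.mem_support_bind_iff _ _ _).1 hp
  obtain ⟨um, hum, hp⟩ := (PMF.mem_support_bind_iff _ _ _).1 hp
  rw [PMF.mem_support_pure_iff] at hp
  subst hp
  exact one_sub_mem_Icc (mul_mem_Icc (hZ ζ hζ) (prod_mem_Icc fun i =>
    one_sub_mem_Icc (h _ (mem_support_of_mem_support_iid hum i))))

theorem sndInUnit_uLawOf {k : ℕ} {α : ℝ≥0} {Z : PMF ℝ}
    (hZ : ∀ ζ ∈ Z.support, ζ ∈ Set.Icc (0 : ℝ) 1) : ∀ ℓ, SndInUnit (uLawOf k α Z ℓ)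
  | 0 => by
    intro p hp
    rw [uLawOf, PMF.mem_support_pure_iff] at hp
    subst hp
    simp
  | ℓ + 1 => ((sndInUnit_uLawOf hZ ℓ).hStepOf hZ).uStep

theorem sndInUnit_hLawOf {k : ℕ} {α : ℝ≥0} {Z : PMF ℝ}
    (hZ : ∀ ζ ∈ Z.support, ζ ∈ Set.Icc (0 : ℝ) 1) (ℓ : ℕ) : SndInUnit (hLawOf k α Z ℓ) :=
  (sndInUnit_uLawOf hZ ℓ).hStepOf hZ

/-! ### Agreement of conditional means -/

/-- The marginal of the first component weighted by `w` of the second component is the same. -/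
def WeightedEq (w : ℝ → ℝ≥0∞) (μ μ' : PMF (ℝ × ℝ)) : Prop :=
  ∀ g : ℝ → ℝ≥0∞, (∀ x, g x ≤ 1) →
    (expect μ fun p => g p.1 * w p.2) = expect μ' fun p => g p.1 * w p.2

/-- A product weight lets the coordinates be exchanged one at a time, with the others held fixed. -/
theorem WeightedEq.iid {w : ℝ → ℝ≥0∞} {μ μ' : PMF (ℝ × ℝ)} (h : WeightedEq w μ μ') :
    ∀ {n : ℕ} (G : (Fin n → ℝ) → ℝ≥0∞), (∀ x, G x ≤ 1) →
      (expect (iid μ n) fun s => G (fun i => (s i).1) * ∏ i, w (s i).2) =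
        expect (iid μ' n) fun s => G (fun i => (s i).1) * ∏ i, w (s i).2
  | 0, G, _ => by rw [iid_zero, iid_zero]
  | n + 1, G, hG => by
    have key : ∀ ν : PMF (ℝ × ℝ),
        (expect (KSatTree.iid ν (n + 1)) fun s => G (fun i => (s i).1) * ∏ i, w (s i).2) =
          expect ν fun p => (expect (KSatTree.iid ν n) fun s =>
            G (Fin.cons p.1 fun i => (s i).1) * ∏ i, w (s i).2) * w p.2 := by
      intro ν
      rw [iid_succ, expect_bind]
      congr 1; funext p
      rw [expect_bind, ← expect_mul_const]
      congr 1; funext s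
      rw [expect_pure, Fin.prod_univ_succ]
      have : (fun i => (Fin.cons p s : Fin (n + 1) → ℝ × ℝ) i |>.1) =
          Fin.cons p.1 fun i => (s i).1 := by
        funext i
        refine Fin.cases ?_ (fun i => ?_) i <;> simp
      rw [this]
      simp only [Fin.cons_zero, Fin.cons_succ]
      ring
    rw [key, key]
    have step : ∀ p : ℝ × ℝ,
        (expect (KSatTree.iid μ n) fun s => G (Fin.cons p.1 fun i => (s i).1) * ∏ i, w (s i).2) =
          expect (KSatTree.iid μ' n) fun s =>
            G (Fin.cons p.1 fun i => (s i).1) * ∏ i, w (s i).2 := fun p =>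
      h.iid (fun x => G (Fin.cons p.1 x)) fun x => hG _
    simp only [step, ← expect_mul_const]
    -- The tail already has law `μ'`; with the tail outermost, the hypothesis applies to the head
    -- alone.
    rw [expect_comm, expect_comm μ']
    congr 1; funext s
    have := h (fun x => G (Fin.cons x fun i => (s i).1)) fun x => hG _
    simp only [mul_right_comm _ (∏ i, w (s i).2)]
    rw [expect_mul_const, expect_mul_const, this]

/-- The same law of the first component, and the same conditional mean of the second one. -/
def MeanEq (μ μ' : PMF (ℝ × ℝ)) : Prop :=
  WeightedEq (fun _ => 1) μ μ' ∧ WeightedEq ENNReal.ofReal μ μ'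

theorem MeanEq.refl (μ : PMF (ℝ × ℝ)) : MeanEq μ μ := ⟨fun _ _ => rfl, fun _ _ => rfl⟩

theorem expect_weight_add_weight {μ : PMF (ℝ × ℝ)} (hμ : SndInUnit μ) (g : ℝ → ℝ≥0∞) :
    (expect μ fun p => g p.1 * ENNReal.ofReal p.2) +
      (expect μ fun p => g p.1 * ENNReal.ofReal (1 - p.2)) = expect μ fun p => g p.1 * 1 := by
  rw [← expect_add]
  refine expect_congr fun p hp => ?_
  rw [← mul_add, ← ENNReal.ofReal_add (hμ p hp).1 (one_sub_mem_Icc (hμ p hp)).1]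
  simp

theorem expect_weight_ne_top (μ : PMF (ℝ × ℝ)) {g : ℝ → ℝ≥0∞}
    (hg : ∀ x, g x ≤ 1) : (expect μ fun p => g p.1 * 1) ≠ ∞ :=
  ((expect_le_one fun p => by simpa using hg p.1).trans_lt ENNReal.one_lt_top).ne

/-- The weights `x` and `1 - x` add up to `1`, so one is obtained from the other by subtraction.
Test functions bounded by `1` keep the subtracted term finite. -/
theorem MeanEq.weightedEq_one_sub {μ μ' : PMF (ℝ × ℝ)} (hμ : SndInUnit μ) (hμ' : SndInUnit μ')
    (h : MeanEq μ μ') : WeightedEq (fun x => ENNReal.ofReal (1 - x)) μ μ' := by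
  intro g hg
  have h1 := expect_weight_add_weight hμ g
  have h2 := expect_weight_add_weight hμ' g
  rw [← h.1 g hg, ← h1, ← h.2 g hg] at h2
  refine ((ENNReal.add_right_inj ?_).1 h2).symm
  refine ne_top_of_le_ne_top (expect_weight_ne_top μ hg) ?_
  rw [← h1]
  exact le_self_add

theorem meanEq_of_one_sub {μ μ' : PMF (ℝ × ℝ)} (hμ : SndInUnit μ) (hμ' : SndInUnit μ')
    (h : WeightedEq (fun _ => 1) μ μ') (h' : WeightedEq (fun x => ENNReal.ofReal (1 - x)) μ μ') :
    MeanEq μ μ' := by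
  refine ⟨h, fun g hg => ?_⟩
  have h1 := expect_weight_add_weight hμ g
  have h2 := expect_weight_add_weight hμ' g
  rw [← h g hg, ← h1, ← h' g hg] at h2
  refine ((ENNReal.add_left_inj ?_).1 h2).symm
  refine ne_top_of_le_ne_top (expect_weight_ne_top μ hg) ?_
  rw [← h1]
  exact le_add_self

/-- `û` is a bounded function of the `h i` times the product of the `ĥ i`; the former goes into the
test function, the latter is the product weight. -/
theorem MeanEq.uStep {k : ℕ} {ν ν' : PMF (ℝ × ℝ)} (hν : SndInUnit ν) (hν' : SndInUnit ν')
    (h : MeanEq ν ν') : MeanEq (uStep k ν) (uStep k ν') := by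
  constructor
  · intro g hg
    simp only [KSatTree.uStep, expect_bind, expect_pure]
    simpa using h.1.iid (n := k - 1) (fun x => g (bpFun x)) fun x => hg _
  · intro g hg
    simp only [KSatTree.uStep, expect_bind, expect_pure]
    have key : ∀ ν : PMF (ℝ × ℝ), SndInUnit ν →
        (expect (KSatTree.iid ν (k - 1)) fun s => g (bpFun fun i => (s i).1) *
            ENNReal.ofReal (∏ i, ((1 - Real.tanh (s i).1) / 2 * (s i).2))) =
          expect (KSatTree.iid ν (k - 1)) fun s =>
            (fun x : Fin (k - 1) → ℝ => g (bpFun x) *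
              ∏ i, ENNReal.ofReal ((1 - Real.tanh (x i)) / 2)) (fun i => (s i).1) *
            ∏ i, ENNReal.ofReal (s i).2 := by
      intro ν hν
      refine expect_congr fun s hs => ?_
      rw [ENNReal.ofReal_prod_of_nonneg, mul_assoc, ← Finset.prod_mul_distrib]
      · congr 1
        refine Finset.prod_congr rfl fun i _ => ?_
        rw [ENNReal.ofReal_mul (half_one_sub_tanh_mem_Icc _).1]
      · intro i _
        exact mul_nonneg (half_one_sub_tanh_mem_Icc _).1
          (hν _ (mem_support_of_mem_support_iid hs i)).1
    rw [key ν hν, key ν' hν']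
    refine h.2.iid (fun x : Fin (k - 1) → ℝ => g (bpFun x) *
      ∏ i, ENNReal.ofReal ((1 - Real.tanh (x i)) / 2)) fun x =>
        mul_le_one' (hg _) (Finset.prod_le_one' fun i _ => ?_)
    exact ENNReal.ofReal_le_one.2 (half_one_sub_tanh_mem_Icc _).2

theorem expect_hStepOf (k : ℕ) (α : ℝ≥0) (Z : PMF ℝ) (μ : PMF (ℝ × ℝ)) (f : ℝ × ℝ → ℝ≥0∞) :
    expect (hStepOf k α Z μ) f =
      expect (poisson (α * k / 2)) fun lp => expect (poisson (α * k / 2)) fun lm =>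
        expect Z fun ζ => expect (iid μ lp) fun up => expect (iid μ lm) fun um =>
          f ((∑ i, (up i).1) - (∑ i, (um i).1), 1 - ζ * ∏ i, (1 - (um i).2)) := by
  simp only [hStepOf, expect_bind, expect_pure]

theorem WeightedEq.expect_iid_iid {μ μ' : PMF (ℝ × ℝ)} {w : ℝ → ℝ≥0∞} (h : WeightedEq (fun _ => 1) μ μ')
    (h' : WeightedEq w μ μ') (lp lm : ℕ) {g : ℝ → ℝ≥0∞} (hg : ∀ x, g x ≤ 1) :
    (expect (KSatTree.iid μ lp) fun up => expect (KSatTree.iid μ lm) fun um =>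
      g ((∑ i, (up i).1) - (∑ i, (um i).1)) * ∏ i, w (um i).2) =
    expect (KSatTree.iid μ' lp) fun up => expect (KSatTree.iid μ' lm) fun um =>
      g ((∑ i, (up i).1) - (∑ i, (um i).1)) * ∏ i, w (um i).2 := by
  have h1 : ∀ up : Fin lp → ℝ × ℝ, _ := fun up =>
    h'.iid (n := lm) (fun x => g ((∑ i, (up i).1) - ∑ i, x i)) fun x => hg _
  simp only [h1]
  rw [expect_comm, expect_comm (KSatTree.iid μ' lp)]
  congr 1; funext um
  rw [expect_mul_const, expect_mul_const]
  congr 1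
  simpa using h.iid (n := lp) (fun x => g ((∑ i, x i) - ∑ i, (um i).1)) fun x => hg _

/-- The complement `1 - ĥ = ζ * ∏ (1 - û)` is a pure product, so complements are compared; `ζ` is
independent of the rest and contributes only its mean. -/
theorem MeanEq.hStepOf {k : ℕ} {α : ℝ≥0} {Z Z' : PMF ℝ} {μ μ' : PMF (ℝ × ℝ)}
    (hZ : ∀ ζ ∈ Z.support, ζ ∈ Set.Icc (0 : ℝ) 1) (hZ' : ∀ ζ ∈ Z'.support, ζ ∈ Set.Icc (0 : ℝ) 1)
    (hZZ' : expect Z ENNReal.ofReal = expect Z' ENNReal.ofReal)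
    (hμ : SndInUnit μ) (hμ' : SndInUnit μ') (h : MeanEq μ μ') :
    MeanEq (hStepOf k α Z μ) (hStepOf k α Z' μ') := by
  refine meanEq_of_one_sub (hμ.hStepOf hZ) (hμ'.hStepOf hZ') ?_ ?_
  · intro g hg
    simp only [expect_hStepOf, expect_const]
    congr 1; funext lp; congr 1; funext lm
    simpa using WeightedEq.expect_iid_iid h.1 h.1 lp lm hg
  · intro g hg
    simp only [expect_hStepOf]
    congr 1; funext lp; congr 1; funext lm
    have key : ∀ (Z : PMF ℝ) (μ : PMF (ℝ × ℝ)), (∀ ζ ∈ Z.support, ζ ∈ Set.Icc (0 : ℝ) 1) →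
        SndInUnit μ →
        (expect Z fun ζ => expect (KSatTree.iid μ lp) fun up => expect (KSatTree.iid μ lm) fun um =>
          g ((∑ i, (up i).1) - (∑ i, (um i).1)) *
            ENNReal.ofReal (1 - (1 - ζ * ∏ i, (1 - (um i).2)))) =
          expect Z ENNReal.ofReal * expect (KSatTree.iid μ lp) fun up =>
            expect (KSatTree.iid μ lm) fun um =>
              g ((∑ i, (up i).1) - (∑ i, (um i).1)) * ∏ i, ENNReal.ofReal (1 - (um i).2) := by
      intro Z μ hZ hμ
      rw [← expect_mul_const]
      refine expect_congr fun ζ hζ => ?_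
      rw [← expect_const_mul]
      congr 1; funext up
      rw [← expect_const_mul]
      refine expect_congr fun um hum => ?_
      rw [sub_sub_cancel, ENNReal.ofReal_mul (hZ ζ hζ).1, ENNReal.ofReal_prod_of_nonneg]
      · ring
      · intro i _
        exact (one_sub_mem_Icc (hμ _ (mem_support_of_mem_support_iid hum i))).1
    rw [key Z μ hZ hμ, key Z' μ' hZ' hμ', hZZ',
      WeightedEq.expect_iid_iid h.1 (h.weightedEq_one_sub hμ hμ') lp lm hg]

theorem meanEq_uLawOf {k : ℕ} {α : ℝ≥0} {Z Z' : PMF ℝ}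
    (hZ : ∀ ζ ∈ Z.support, ζ ∈ Set.Icc (0 : ℝ) 1) (hZ' : ∀ ζ ∈ Z'.support, ζ ∈ Set.Icc (0 : ℝ) 1)
    (hZZ' : expect Z ENNReal.ofReal = expect Z' ENNReal.ofReal) : ∀ ℓ, MeanEq (uLawOf k α Z ℓ) (uLawOf k α Z' ℓ)
  | 0 => MeanEq.refl _
  | ℓ + 1 => ((meanEq_uLawOf hZ hZ' hZZ' ℓ).hStepOf hZ hZ' hZZ' (sndInUnit_uLawOf hZ ℓ)
      (sndInUnit_uLawOf hZ' ℓ)).uStep (sndInUnit_hLawOf hZ ℓ) (sndInUnit_hLawOf hZ' ℓ)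

theorem meanEq_hLawOf {k : ℕ} {α : ℝ≥0} {Z Z' : PMF ℝ}
    (hZ : ∀ ζ ∈ Z.support, ζ ∈ Set.Icc (0 : ℝ) 1) (hZ' : ∀ ζ ∈ Z'.support, ζ ∈ Set.Icc (0 : ℝ) 1)
    (hZZ' : expect Z ENNReal.ofReal = expect Z' ENNReal.ofReal) (ℓ : ℕ) : MeanEq (hLawOf k α Z ℓ) (hLawOf k α Z' ℓ) :=
  (meanEq_uLawOf hZ hZ' hZZ' ℓ).hStepOf hZ hZ' hZZ' (sndInUnit_uLawOf hZ ℓ)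
    (sndInUnit_uLawOf hZ' ℓ)

/-! ### Replacing `ζ` by its mean -/

theorem support_zetaLaw (θ : ℝ≥0) (hθ : θ ≤ 1) :
    ∀ ζ ∈ (zetaLaw θ hθ).support, ζ ∈ Set.Icc (0 : ℝ) 1 := by
  intro ζ hζ
  rw [zetaLaw] at hζ
  obtain ⟨b, -, hζ⟩ := (PMF.mem_support_bind_iff _ _ _).1 hζ
  rw [PMF.mem_support_pure_iff] at hζ
  subst hζ
  cases b <;> simp

theorem support_pure_one_sub (θ : ℝ≥0) (hθ : θ ≤ 1) :
    ∀ ζ ∈ (PMF.pure (1 - (θ : ℝ))).support, ζ ∈ Set.Icc (0 : ℝ) 1 := by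
  intro ζ hζ
  rw [PMF.mem_support_pure_iff] at hζ
  subst hζ
  exact one_sub_mem_Icc ⟨θ.2, by exact_mod_cast hθ⟩

theorem expect_zetaLaw (θ : ℝ≥0) (hθ : θ ≤ 1) :
    expect (zetaLaw θ hθ) ENNReal.ofReal = expect (PMF.pure (1 - (θ : ℝ))) ENNReal.ofReal := by
  rw [zetaLaw, expect_bind, expect_pure]
  simp only [expect_pure]
  rw [expect, tsum_fintype, Fintype.sum_bool]
  simp only [PMF.ofFintype_apply, cond_true, cond_false, ENNReal.ofReal_zero, mul_zero, zero_add,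
    ENNReal.ofReal_one, mul_one]
  rw [ENNReal.ofReal_sub 1 (NNReal.coe_nonneg θ), ENNReal.ofReal_one, ENNReal.ofReal_coe_nnreal]

theorem meanEq_hLaw (k : ℕ) (α θ : ℝ≥0) (hθ : θ ≤ 1) (ℓ : ℕ) :
    MeanEq (hLaw k α θ hθ ℓ) (hLawOf k α (PMF.pure (1 - (θ : ℝ))) ℓ) := by
  rw [hLaw_eq_hLawOf]
  exact meanEq_hLawOf (support_zetaLaw θ hθ) (support_pure_one_sub θ hθ) (expect_zetaLaw θ hθ) ℓ

theorem sndInUnit_hLaw (k : ℕ) (α θ : ℝ≥0) (hθ : θ ≤ 1) (ℓ : ℕ) :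
    SndInUnit (hLaw k α θ hθ ℓ) := by
  rw [hLaw_eq_hLawOf]
  exact sndInUnit_hLawOf (support_zetaLaw θ hθ) ℓ

/-! ### Splitting a Poisson number of coin flips -/

/-- A fair coin. -/
noncomputable def coin : PMF Bool := PMF.uniformOfFintype Bool

theorem coin_apply (c : Bool) : coin c = 2⁻¹ := by
  simp [coin, PMF.uniformOfFintype_apply]

theorem coin_bind_apply {A : Type} (f : Bool → PMF A) (a : A) :
    coin.bind f a = 2⁻¹ * (f true a + f false a) := by
  rw [PMF.bind_apply, tsum_fintype, Fintype.sum_bool, coin_apply, coin_apply, mul_add]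

/-- The numbers of heads and tails among `n` coin flips. -/
noncomputable def countLaw : ℕ → PMF (ℕ × ℕ)
  | 0 => PMF.pure (0, 0)
  | n + 1 => coin.bind fun c => (countLaw n).map fun p => cond c (p.1 + 1, p.2) (p.1, p.2 + 1)

theorem map_apply_of_injective {A B : Type} (p : PMF A) {f : A → B} (hf : f.Injective) (a : A) :
    p.map f (f a) = p a := by
  rw [PMF.map_apply, tsum_eq_single a]
  · simp
  · intro b hb
    rw [if_neg fun h => hb (hf h).symm]

theorem map_apply_eq_zero {A B : Type} (p : PMF A) {f : A → B} {b : B} (h : ∀ a, b ≠ f a) :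
    p.map f b = 0 := by
  rw [PMF.map_apply]
  simp [h]

/-- The binomial law; conditioning on one flip gives Pascal's rule, with boundary cases when one
count is zero. -/
theorem countLaw_apply : ∀ n i j : ℕ,
    countLaw n (i, j) = if i + j = n then (n.choose i : ℝ≥0∞) * 2⁻¹ ^ n else 0
  | 0, i, j => by
    rw [countLaw, PMF.pure_apply]
    by_cases h : i + j = 0
    · obtain ⟨rfl, rfl⟩ : i = 0 ∧ j = 0 := by omega
      simp
    · rw [if_neg h, if_neg]
      simp only [Prod.mk.injEq]
      omega
  | n + 1, i, j => by
    have inj1 : Function.Injective fun p : ℕ × ℕ => (p.1 + 1, p.2) := by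
      rintro ⟨a, b⟩ ⟨c, d⟩ h
      simpa using h
    have inj2 : Function.Injective fun p : ℕ × ℕ => (p.1, p.2 + 1) := by
      rintro ⟨a, b⟩ ⟨c, d⟩ h
      simpa using h
    have e1 : ∀ i j, (countLaw n).map (fun p : ℕ × ℕ => (p.1 + 1, p.2)) (i + 1, j) =
        countLaw n (i, j) := fun i j => map_apply_of_injective (countLaw n) inj1 (i, j)
    have e2 : ∀ i j, (countLaw n).map (fun p : ℕ × ℕ => (p.1, p.2 + 1)) (i, j + 1) =
        countLaw n (i, j) := fun i j => map_apply_of_injective (countLaw n) inj2 (i, j)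
    have z1 : ∀ j, (countLaw n).map (fun p : ℕ × ℕ => (p.1 + 1, p.2)) (0, j) = 0 :=
      fun j => map_apply_eq_zero _ fun a h => by simp at h
    have z2 : ∀ i, (countLaw n).map (fun p : ℕ × ℕ => (p.1, p.2 + 1)) (i, 0) = 0 :=
      fun j => map_apply_eq_zero _ fun a h => by simp at h
    rw [countLaw, coin_bind_apply]
    simp only [cond_true, cond_false]
    rcases i with _ | i <;> rcases j with _ | j
    · rw [z1, z2, if_neg (by omega)]
      simp
    · rw [z1, e2, countLaw_apply n, zero_add, zero_add, zero_add]
      simp only [add_left_inj, Nat.choose_zero_right, pow_succ']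
      split_ifs <;> ring
    · rw [e1, z2, countLaw_apply n, add_zero, add_zero]
      simp only [add_left_inj, add_zero]
      split_ifs with h
      · subst h
        simp only [Nat.choose_self, pow_succ']
        ring
      · ring
    · rw [e1, e2, countLaw_apply n, countLaw_apply n]
      have h1 : (i + 1 + (j + 1) = n + 1) ↔ (i + (j + 1) = n) := by omega
      have h2 : (i + 1 + j = n) ↔ (i + (j + 1) = n) := by omega
      simp only [h1, h2]
      split_ifs
      · rw [Nat.choose_succ_succ, Nat.cast_add, pow_succ']
        ring
      · ring

theorem poisson_apply (r : ℝ≥0) (n : ℕ) :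
    poisson r n = ENNReal.ofReal (Real.exp (-r) * r ^ n / n.factorial) := by
  rw [poisson, Measure.toPMF_apply, poissonMeasure_singleton]

/-- Poisson thinning: only `n = i + j` contributes to the mass at `(i, j)`, and the binomial
coefficient turns `1 / n!` into `1 / (i! j!)`. -/
theorem poisson_bind_countLaw (r : ℝ≥0) :
    (poisson (2 * r)).bind countLaw =
      (poisson r).bind fun i => (poisson r).bind fun j => PMF.pure (i, j) := by
  ext ⟨i, j⟩
  rw [PMF.bind_apply, tsum_eq_single (i + j), PMF.bind_apply, tsum_eq_single i, PMF.bind_apply,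
    tsum_eq_single j]
  · rw [PMF.pure_apply_self, mul_one, countLaw_apply, if_pos rfl, poisson_apply, poisson_apply,
      poisson_apply]
    have h2 : ((i + j).choose i : ℝ≥0∞) * 2⁻¹ ^ (i + j) =
        ENNReal.ofReal ((i + j).choose i * 2⁻¹ ^ (i + j)) := by
      rw [ENNReal.ofReal_mul (by positivity), ENNReal.ofReal_natCast,
        ENNReal.ofReal_pow (by positivity), ENNReal.ofReal_inv_of_pos (by norm_num)]
      norm_num
    rw [h2, ← ENNReal.ofReal_mul (by positivity), ← ENNReal.ofReal_mul (by positivity)]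
    congr 1
    have hc : ((i + j).choose i : ℝ) * i.factorial * j.factorial = (i + j).factorial := by
      rw [Nat.choose_symm_add]
      exact_mod_cast Nat.add_choose_mul_factorial_mul_factorial i j
    have he : Real.exp (-((2 * r : ℝ≥0) : ℝ)) = Real.exp (-r) * Real.exp (-r) := by
      rw [← Real.exp_add]
      congr 1
      push_cast
      ring
    rw [he, ← hc]
    have hi : (i.factorial : ℝ) ≠ 0 := by positivity
    have hj : (j.factorial : ℝ) ≠ 0 := by positivity
    have hn : ((i + j).choose i : ℝ) ≠ 0 := by
      exact_mod_cast (Nat.choose_pos (Nat.le_add_right i j)).ne'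
    have hp : (2 : ℝ) ^ (i + j) * 2⁻¹ ^ (i + j) = 1 := by
      rw [← mul_pow]
      norm_num
    push_cast
    rw [mul_pow]
    field_simp
    rw [show (2 : ℝ)⁻¹ = 1 / 2 by norm_num] at *
    rw [pow_add (r : ℝ), div_pow, one_pow]
    field_simp
  · intro j' h
    rw [PMF.pure_apply, if_neg, mul_zero]
    simpa using fun h' => h h'.symm
  · intro i' h
    rw [PMF.bind_apply, ENNReal.tsum_eq_zero.2, mul_zero]
    intro j'
    rw [PMF.pure_apply, if_neg, mul_zero]
    intro h'
    exact h (Prod.mk.inj h').1.symm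
  · intro n h
    rw [countLaw_apply, if_neg (Ne.symm h), mul_zero]

/-- Signed sum of the first components, and product of the complements of the second components with
negative sign. -/
noncomputable def aggregate {n : ℕ} (s : Fin n → Bool × (ℝ × ℝ)) : ℝ × ℝ :=
  (∑ i, cond (s i).1 (s i).2.1 (-(s i).2.1), ∏ i, cond (s i).1 1 (1 - (s i).2.2))

/-- The aggregate law for given numbers of positive and negative signs. -/
noncomputable def splitLaw (μ : PMF (ℝ × ℝ)) (p : ℕ × ℕ) : PMF (ℝ × ℝ) :=
  (iid μ p.1).bind fun up => (iid μ p.2).bind fun um =>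
    PMF.pure ((∑ i, (up i).1) - (∑ i, (um i).1), ∏ i, (1 - (um i).2))

/-- The law of a fair sign and an independent `μ`-distributed vector. -/
noncomputable def signedLaw (μ : PMF (ℝ × ℝ)) : PMF (Bool × (ℝ × ℝ)) :=
  coin.bind fun c => μ.bind fun u => PMF.pure (c, u)

/-- Sums and products forget the order of the entries, so the first signed entry may be put at the
head of the family of its sign. -/
theorem iid_signedLaw_map_aggregate (μ : PMF (ℝ × ℝ)) :
    ∀ n, (iid (signedLaw μ) n).map aggregate = (countLaw n).bind (splitLaw μ)
  | 0 => by
    rw [iid_zero, countLaw, PMF.pure_map, PMF.pure_bind, splitLaw, iid_zero, PMF.pure_bind,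
      PMF.pure_bind]
    simp [aggregate]
  | n + 1 => by
    have hn := iid_signedLaw_map_aggregate μ n
    have lhs : (iid (signedLaw μ) (n + 1)).map aggregate =
        (signedLaw μ).bind fun cu => ((iid (signedLaw μ) n).map aggregate).bind fun x =>
          PMF.pure (cond cu.1 cu.2.1 (-cu.2.1) + x.1, cond cu.1 1 (1 - cu.2.2) * x.2) := by
      simp only [iid_succ, map_eq_bind, PMF.bind_bind, PMF.pure_bind]
      congr 1; funext cu; congr 1; funext s
      simp only [aggregate, Fin.sum_univ_succ, Fin.prod_univ_succ, Fin.cons_zero, Fin.cons_succ]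
    rw [lhs, hn, countLaw]
    simp only [signedLaw, map_eq_bind, PMF.bind_bind, PMF.pure_bind]
    congr 1; funext c
    rw [PMF.bind_comm]
    congr 1; funext p
    cases c
    · simp only [cond_false, splitLaw, iid_succ, PMF.bind_bind, PMF.pure_bind]
      rw [PMF.bind_comm]
      congr 1; funext up; congr 1; funext u; congr 1; funext um; congr 1
      simp only [Fin.sum_univ_succ, Fin.prod_univ_succ, Fin.cons_zero, Fin.cons_succ]
      congr 1
      ring
    · simp only [cond_true, splitLaw, iid_succ, PMF.bind_bind, PMF.pure_bind]
      congr 1; funext u; congr 1; funext up; congr 1; funext um; congr 1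
      simp only [Fin.sum_univ_succ, Fin.cons_zero, Fin.cons_succ]
      congr 1
      · ring
      · ring

theorem poisson_bind_iid_signedLaw (r : ℝ≥0) (μ : PMF (ℝ × ℝ)) :
    ((poisson (2 * r)).bind fun n => (iid (signedLaw μ) n).map aggregate) =
      (poisson r).bind fun lp => (poisson r).bind fun lm => splitLaw μ (lp, lm) := by
  simp only [iid_signedLaw_map_aggregate]
  rw [← PMF.bind_bind, poisson_bind_countLaw]
  simp only [PMF.bind_bind, PMF.pure_bind]

/-! ### The recursion on a given tree -/

namespace Tree

variable {k : ℕ}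

/-- The pair `(h, ĥ)` of a tree, where `h` is the log-likelihood ratio of the root having the value
`!b` rather than `b`, and `ĥ` is the conditional probability that the root is frozen, given that it
has the value `b`. -/
noncomputable def message (θ : ℝ) : Tree k → Bool → ℝ × ℝ
  | node _ z child, b =>
    have x := aggregate fun a => ((if hk : 0 < k then z a ⟨0, hk⟩ == b else true),
      (bpFun fun j => (message θ (child a j) (z a ⟨j + 1, by omega⟩)).1,
        ∏ j, ((1 - Real.tanh (message θ (child a j) (z a ⟨j + 1, by omega⟩)).1) / 2 *
          (message θ (child a j) (z a ⟨j + 1, by omega⟩)).2)))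
    (x.1, 1 - (1 - θ) * x.2)

end Tree

theorem uniform_map_eval (k : ℕ) (hk : 0 < k) (b : Bool) :
    (PMF.uniformOfFintype (Fin k → Bool)).map (fun z => z ⟨0, hk⟩ == b) = coin := by
  obtain ⟨m, rfl⟩ : ∃ m, k = m + 1 := ⟨k - 1, by omega⟩
  ext c
  rw [PMF.map_apply, coin_apply, tsum_fintype]
  simp only [PMF.uniformOfFintype_apply]
  rw [← (Fin.consEquiv fun _ => Bool).sum_comp, Fintype.sum_prod_type]
  have : ∀ (x : Bool) (y : Fin m → Bool),
      ((Fin.consEquiv fun _ : Fin (m + 1) => Bool) (x, y)) ⟨0, hk⟩ = x := fun x y => rfl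
  simp only [this, Finset.sum_const, Fintype.sum_bool]
  have e : (2 : ℝ≥0∞) ^ m * (2 ^ (m + 1))⁻¹ = 2⁻¹ := by
    rw [pow_succ, ENNReal.mul_inv (by simp) (by simp), ← mul_assoc, ENNReal.mul_inv_cancel (by simp)
      (by simp), one_mul]
  cases b <;> cases c <;> simp [e]

theorem treeLaw_map_message (k : ℕ) (hk : 0 < k) (α : ℝ≥0) (θ : ℝ) :
    ∀ (ℓ : ℕ) (b : Bool), (treeLaw k α ℓ).map (fun T => T.message θ b) =
      hLawOf k α (PMF.pure (1 - θ)) ℓ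
  | 0, b => by
    rw [treeLaw, PMF.pure_map, hLawOf, hStepOf, uLawOf]
    simp only [iid_pure, PMF.pure_bind]
    simp [Tree.message, aggregate]
  | ℓ + 1, b => by
    have ih := treeLaw_map_message k hk α θ ℓ
    set ν := hLawOf k α (PMF.pure (1 - θ)) ℓ with hν
    -- One root clause contributes a fair sign and an independent `(u, û)`: conditionally on all
    -- violating values, the child messages are independent copies of `ν`.
    have clause : ((PMF.uniformOfFintype (Fin k → Bool)).bind fun z =>
        (iid (treeLaw k α ℓ) (k - 1)).bind fun c => PMF.pure (z ⟨0, hk⟩ == b,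
          (bpFun fun j => ((c j).message θ (z ⟨j + 1, by omega⟩)).1,
            ∏ j, ((1 - Real.tanh ((c j).message θ (z ⟨j + 1, by omega⟩)).1) / 2 *
              ((c j).message θ (z ⟨j + 1, by omega⟩)).2)))) = signedLaw (uStep k ν) := by
      rw [signedLaw, ← uniform_map_eval k hk b, PMF.bind_map]
      congr 1; funext z
      have hz := map_iid (n := k - 1) (μ := treeLaw k α ℓ) (ν := ν)
        (fun j T => T.message θ (z ⟨j + 1, by omega⟩)) fun j => ih _
      simp only [uStep, Function.comp, ← hz, map_eq_bind, PMF.bind_bind, PMF.pure_bind]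
    have hr : α * k = 2 * (α * k / 2) := by
      rw [mul_div_cancel₀]
      exact two_ne_zero
    have main := poisson_bind_iid_signedLaw (α * k / 2) (uStep k ν)
    rw [← hr, ← clause] at main
    simp only [← iid_bind_iid] at main
    have main' := congrArg (PMF.map fun x : ℝ × ℝ => (x.1, 1 - (1 - θ) * x.2)) main
    rw [treeLaw, hLawOf, uLawOf, ← hLawOf, ← hν, hStepOf]
    simp only [splitLaw, map_eq_bind, PMF.bind_bind, PMF.pure_bind] at main' ⊢
    rw [← main']
    simp only [Tree.message, hk, dite_true]

/-! ### Unit clause propagation on a tree -/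

namespace Formula

variable {k : ℕ} {V C : Type} {F : Formula k V C} {U : Finset V} {x : V → Bool} {i : V}

/-- Unit clause propagation from a solution only produces the values of this solution. -/
theorem IsSolution.eq_of_derived (hx : F.IsSolution x) {b : Bool} (h : F.Derived U x i b) :
    x i = b := by
  induction h with
  | fixed i hi => rfl
  | unit a p _ ih =>
    obtain ⟨q, hq⟩ := hx a
    by_cases hqp : q = p
    · subst hqp
      exact Bool.eq_not.2 hq
    · exact absurd (ih q hqp) hq

theorem frozen_iff : F.Frozen U x i ↔ ∃ b, F.Derived U x i b := by
  refine ⟨?_, fun h => ?_⟩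
  · rintro (h | h)
    · exact ⟨_, .fixed i h⟩
    · exact h.2
  · by_cases hi : i ∈ U
    · exact .inl hi
    · exact .inr ⟨hi, h⟩

theorem IsSolution.frozen_iff_derived (hx : F.IsSolution x) :
    F.Frozen U x i ↔ F.Derived U x i (x i) := by
  rw [frozen_iff]
  refine ⟨?_, fun h => ⟨_, h⟩⟩
  rintro ⟨b, hb⟩
  rwa [hx.eq_of_derived hb]

end Formula

namespace Tree

variable {k : ℕ}

/-- The membership in the set of fixed variables and the value of each variable. -/
abbrev Config (T : Tree k) : Type := T.Var → Bool × Bool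

noncomputable instance (T : Tree k) : Fintype T.Config :=
  haveI := Classical.decEq T.Var
  inferInstance

/-- The assignment of a configuration. -/
def Config.value {T : Tree k} (s : T.Config) (v : T.Var) : Bool := (s v).2

/-- The set of fixed variables of a configuration. -/
def Config.fixedSet {T : Tree k} (s : T.Config) : Finset T.Var :=
  Finset.univ.filter fun v => (s v).1 = true

theorem Config.mem_fixedSet {T : Tree k} {s : T.Config} {v : T.Var} :
    v ∈ s.fixedSet ↔ (s v).1 = true := by
  simp [Config.fixedSet]

/-- The assignment is a solution. -/
def Config.Sat {T : Tree k} (s : T.Config) : Prop := T.formula.IsSolution s.value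

/-- The root is frozen. -/
def Config.RootFrozen {T : Tree k} (s : T.Config) : Prop :=
  T.formula.Frozen s.fixedSet s.value T.root

section Node

variable {n : ℕ} {z : Fin n → Fin k → Bool} {child : Fin n → Fin (k - 1) → Tree k}

/-- The configuration with given root and restrictions to the subtrees. -/
def join (r : Bool × Bool) (t : ∀ a j, (child a j).Config) : (node n z child).Config :=
  fun v : Option (Σ a : Fin n, Σ j : Fin (k - 1), (child a j).Var) =>
    v.elim r fun w => t w.1 w.2.1 w.2.2

/-- The variable `v` of a subtree as a variable of the tree. -/
def lift (a : Fin n) (j : Fin (k - 1)) (v : (child a j).Var) : (node n z child).Var :=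
  (some ⟨a, j, v⟩ : Option (Σ a : Fin n, Σ j : Fin (k - 1), (child a j).Var))

variable {r : Bool × Bool} {t : ∀ a j, (child a j).Config}

/-- Separates the root position from those of the children. -/
theorem forall_position (hk : 0 < k) {P : Fin k → Prop} :
    (∀ p, P p) ↔ P ⟨0, hk⟩ ∧ ∀ j : Fin (k - 1), P ⟨j + 1, by omega⟩ := by
  refine ⟨fun h => ⟨h _, fun j => h _⟩, fun ⟨h0, h⟩ p => ?_⟩
  by_cases hp : p.val = 0
  · convert h0
  · convert h ⟨p.val - 1, by omega⟩
    simp only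
    omega

theorem sat_join (hk : 0 < k) :
    (join (z := z) r t).Sat ↔
      (∀ a, ¬(z a ⟨0, hk⟩ = r.2 ∧
        ∀ j : Fin (k - 1), (t a j).value (child a j).root = z a ⟨j + 1, by omega⟩)) ∧
      ∀ a j, (t a j).Sat := by
  constructor
  · intro h
    refine ⟨fun a ⟨h0, h1⟩ => ?_, fun a j c => ?_⟩
    · obtain ⟨p, hp⟩ := h (.inl a)
      refine hp ?_
      revert p
      suffices H : ∀ p, (join (z := z) r t).value ((node n z child).varAt (.inl a) p) =
          z a p from fun p _ => H p
      rw [forall_position hk]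
      exact ⟨h0.symm, h1⟩
    · exact h (.inr ⟨a, j, c⟩)
  · rintro ⟨h1, h2⟩ (a | ⟨a, j, c⟩)
    · by_contra hcon
      push Not at hcon
      rw [forall_position hk] at hcon
      exact h1 a ⟨hcon.1.symm, hcon.2⟩
    · exact h2 a j c

theorem derived_lift {a : Fin n} {j : Fin (k - 1)} {v : (child a j).Var} {b : Bool}
    (h : (child a j).formula.Derived (t a j).fixedSet (t a j).value v b) :
    (node n z child).formula.Derived (join (z := z) r t).fixedSet (join (z := z) r t).value
      (lift a j v) b := by
  induction h with
  | fixed v hv =>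
    exact .fixed (lift a j v) (Config.mem_fixedSet.2 (Config.mem_fixedSet.1 hv :))
  | unit c p _ ih =>
    exact .unit (F := (node n z child).formula) (.inr ⟨a, j, c⟩) p ih

/-- Propagation can enter a subtree only at its root, through the clause above, which would assign
the satisfying value. This is impossible when the solution gives that root its violating value. -/
theorem derived_of_derived_lift (hs : (join (z := z) r t).Sat)
    {v : (node n z child).Var} {b : Bool}
    (h : (node n z child).formula.Derived (join (z := z) r t).fixedSet (join (z := z) r t).value
      v b) :
    ∀ {a : Fin n} {j : Fin (k - 1)} {w : (child a j).Var}, v = lift a j w →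
      (t a j).value (child a j).root = z a ⟨j + 1, by omega⟩ →
        (child a j).formula.Derived (t a j).fixedSet (t a j).value w b := by
  induction h with
  | fixed v hv =>
    rintro a j w rfl -
    exact .fixed w (Config.mem_fixedSet.2 (Config.mem_fixedSet.1 hv :))
  | unit c p h ih =>
    intro a j w hw hviol
    rcases c with a' | ⟨a', j', c⟩
    -- A root clause deriving `w` must derive the root of its subtree, with the value opposite to
    -- `hviol`.
    · exfalso
      have hval := Formula.IsSolution.eq_of_derived hs (.unit _ p h)
      have hk : 0 < k := by
        have := j.isLt
        omega
      revert h ih hw hval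
      revert p
      rw [forall_position hk]
      refine ⟨fun _ _ hw => ?_, fun j' _ _ hw hval => ?_⟩
      · cases hw
      · cases hw
        exact Bool.self_ne_not _ (hviol.symm.trans hval)
    · cases hw
      exact .unit c p fun q hq => ih q hq rfl hviol

/-- Clauses inside a subtree do not contain the root, so the last propagation step uses a root
clause; its premises can be checked in the separate subtrees. -/
theorem rootFrozen_join (hk : 0 < k) (hs : (join (z := z) r t).Sat) :
    (join (z := z) r t).RootFrozen ↔ r.1 = true ∨ ∃ a, ∀ j : Fin (k - 1),
      (t a j).value (child a j).root = z a ⟨j + 1, by omega⟩ ∧ (t a j).RootFrozen := by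
  have hsub := ((sat_join hk).1 hs).2
  rw [Config.RootFrozen, Formula.frozen_iff]
  constructor
  · rintro ⟨b, hb⟩
    generalize hv : (node n z child).root = v at hb
    cases hb with
    | fixed _ hi =>
      subst hv
      exact .inl (Config.mem_fixedSet.1 hi :)
    | unit c p h =>
      refine .inr ?_
      rcases c with a | ⟨a, j, c⟩
      · refine ⟨a, fun j => ?_⟩
        have hp : p = ⟨0, hk⟩ := by
          clear h
          revert p
          rw [forall_position hk]
          exact ⟨fun _ => rfl, fun j hv => nomatch hv⟩
        subst hp
        have hj := h ⟨j + 1, by omega⟩ (by simp)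
        have hval := Formula.IsSolution.eq_of_derived hs hj
        exact ⟨hval, Formula.frozen_iff.2 ⟨_, derived_of_derived_lift hs hj rfl hval⟩⟩
      · cases hv
  · rintro (h | ⟨a, h⟩)
    · exact ⟨_, .fixed _ (Config.mem_fixedSet.2 h)⟩
    · refine ⟨_, .unit (F := (node n z child).formula) (.inl a) ⟨0, hk⟩ ?_⟩
      suffices H : ∀ q : Fin k, q ≠ ⟨0, hk⟩ → (node n z child).formula.Derived
          (join (z := z) r t).fixedSet (join (z := z) r t).value
          ((node n z child).varAt (.inl a) q) (z a q) from H
      rw [forall_position hk]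
      refine ⟨fun h => absurd rfl h, fun j _ => ?_⟩
      have hj := (Formula.IsSolution.frozen_iff_derived (hsub a j)).1 (h j).2
      have := derived_lift (z := z) (r := r) hj
      rwa [show (t a j).value (child a j).root = _ from (h j).1] at this

end Node

/-! ### Weighted counts of solutions -/

/-- The weight of the membership of a variable in the set of fixed variables. -/
def bitWeight (θ : ℝ) (u : Bool) : ℝ := cond u θ (1 - θ)

/-- The weight of the set of fixed variables of a configuration. -/
noncomputable def weight (θ : ℝ) {T : Tree k} (s : T.Config) : ℝ := ∏ v, bitWeight θ (s v).1

open Classical in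
/-- The indicator of a proposition. -/
noncomputable def ind (P : Prop) : ℝ := if P then 1 else 0

/-- The total weight of the configurations with property `P`. -/
noncomputable def mass (θ : ℝ) (T : Tree k) (P : T.Config → Prop) : ℝ :=
  ∑ s : T.Config, weight θ s * ind (P s)

theorem ind_and (P Q : Prop) : ind (P ∧ Q) = ind P * ind Q := by
  unfold ind
  split_ifs <;> simp_all

theorem ind_not (P : Prop) : ind (¬P) = 1 - ind P := by
  unfold ind
  split_ifs <;> simp_all

theorem ind_forall {n : ℕ} (P : Fin n → Prop) : ind (∀ i, P i) = ∏ i, ind (P i) := by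
  unfold ind
  by_cases h : ∀ i, P i
  · simp [h]
  · rw [if_neg h]
    push Not at h
    obtain ⟨i, hi⟩ := h
    exact (Finset.prod_eq_zero (Finset.mem_univ i) (if_neg hi)).symm

theorem mass_congr {θ : ℝ} {T : Tree k} {P Q : T.Config → Prop} (h : ∀ s, P s ↔ Q s) :
    mass θ T P = mass θ T Q := by
  unfold mass
  refine Finset.sum_congr rfl fun s _ => ?_
  rw [show P s = Q s from propext (h s)]

theorem mass_false {θ : ℝ} {T : Tree k} : mass θ T (fun _ => False) = 0 := by
  simp [mass, ind]

theorem mass_add_mass_not (θ : ℝ) (T : Tree k) (P Q : T.Config → Prop) :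
    mass θ T (fun s => P s ∧ Q s) + mass θ T (fun s => P s ∧ ¬Q s) = mass θ T P := by
  unfold mass
  rw [← Finset.sum_add_distrib]
  refine Finset.sum_congr rfl fun s _ => ?_
  rw [ind_and, ind_and, ind_not]
  ring

section Node

variable {n : ℕ} {z : Fin n → Fin k → Bool} {child : Fin n → Fin (k - 1) → Tree k}

theorem weight_join (θ : ℝ) (r : Bool × Bool) (t : ∀ a j, (child a j).Config) :
    weight θ (join (z := z) r t) = bitWeight θ r.1 * ∏ a, ∏ j, weight θ (t a j) := by
  have h : weight θ (join (z := z) r t) =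
      ∏ v : Option (Σ a : Fin n, Σ j : Fin (k - 1), (child a j).Var),
        bitWeight θ (join (z := z) r t v).1 := rfl
  rw [h, Fintype.prod_option, Fintype.prod_sigma]
  congr 1
  refine Finset.prod_congr rfl fun a _ => ?_
  rw [Fintype.prod_sigma]
  rfl

/-- A configuration consists of the value at the root and the restrictions to the subtrees. -/
def joinEquiv : (Bool × Bool) × (∀ a j, (child a j).Config) ≃ (node n z child).Config where
  toFun p := join p.1 p.2
  invFun s := (s (node n z child).root, fun a j v => s (lift a j v))
  left_inv _ := rfl
  right_inv s := by
    funext v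
    rcases (v : Option (Σ a : Fin n, Σ j : Fin (k - 1), (child a j).Var)) with _ | w <;> rfl

theorem mass_node (θ : ℝ) (P : (node n z child).Config → Prop) :
    mass θ (node n z child) P = ∑ r : Bool × Bool, ∑ t : ∀ a j, (child a j).Config,
      weight θ (join (z := z) r t) * ind (P (join r t)) := by
  rw [← Fintype.sum_prod_type', mass]
  exact ((joinEquiv (z := z) (child := child)).sum_comp _).symm

/-- Each clause excludes one product event, hence a difference of two products. It serves twice:
with `Q` for a violated clause, and with `Q` for a clause that is violated or implies the root. -/
theorem sum_join (θ : ℝ) (r : Bool × Bool) (Q : ∀ a j, (child a j).Config → Prop) :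
    (∑ t : ∀ a j, (child a j).Config, weight θ (join (z := z) r t) *
      ind (∀ a, (∀ j, (t a j).Sat) ∧ ¬∀ j, (t a j).Sat ∧ Q a j (t a j))) =
      bitWeight θ r.1 * ∏ a, (∏ j, mass θ (child a j) Config.Sat -
        ∏ j, mass θ (child a j) fun s => s.Sat ∧ Q a j s) := by
  have hp : ∀ a, (∏ j, mass θ (child a j) Config.Sat -
        ∏ j, mass θ (child a j) fun s => s.Sat ∧ Q a j s) =
      ∑ t : ∀ j, (child a j).Config, (∏ j, weight θ (t j)) *
        ind ((∀ j, (t j).Sat) ∧ ¬∀ j, (t j).Sat ∧ Q a j (t j)) := by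
    intro a
    simp only [mass]
    rw [Finset.prod_univ_sum, Finset.prod_univ_sum, Fintype.piFinset_univ,
      ← Finset.sum_sub_distrib]
    refine Finset.sum_congr rfl fun t _ => ?_
    rw [Finset.prod_mul_distrib, Finset.prod_mul_distrib, ← mul_sub, ← ind_forall, ← ind_forall]
    congr 1
    rw [ind_and, ind_not]
    by_cases h : ∀ j, (t j).Sat ∧ Q a j (t j)
    · rw [show ind (∀ j, (t j).Sat) = 1 from if_pos fun j => (h j).1]
      ring
    · rw [show ind (∀ j, (t j).Sat ∧ Q a j (t j)) = 0 from if_neg h]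
      ring
  simp only [hp]
  rw [Finset.prod_univ_sum, Fintype.piFinset_univ, Finset.mul_sum]
  refine Finset.sum_congr rfl fun t _ => ?_
  rw [weight_join, ind_forall, Finset.prod_mul_distrib, mul_assoc]

/-- The total weight of the solutions with value `b` at the root. -/
noncomputable def rootMass (θ : ℝ) (T : Tree k) (b : Bool) : ℝ :=
  mass θ T fun s => s.Sat ∧ s.value T.root = b

/-- The total weight of the solutions with value `b` at the root such that the root is frozen. -/
noncomputable def frozenMass (θ : ℝ) (T : Tree k) (b : Bool) : ℝ :=
  mass θ T fun s => s.Sat ∧ s.value T.root = b ∧ s.RootFrozen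

theorem mass_sat (θ : ℝ) (T : Tree k) (b : Bool) :
    mass θ T Config.Sat = rootMass θ T b + rootMass θ T (!b) := by
  rw [rootMass, rootMass, ← mass_add_mass_not θ T Config.Sat fun s => s.value T.root = b]
  congr 1
  refine mass_congr fun s => ?_
  rw [Bool.eq_not]

theorem bitWeight_add (θ : ℝ) : bitWeight θ true + bitWeight θ false = 1 := by
  simp [bitWeight]

theorem prod_mass_violating (hk : 2 ≤ k) (θ : ℝ) (b : Bool) (a : Fin n) :
    (∏ j : Fin (k - 1), mass θ (child a j) fun s => s.Sat ∧
      (z a ⟨0, by omega⟩ = b ∧ s.value (child a j).root = z a ⟨j + 1, by omega⟩)) =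
      cond (z a ⟨0, by omega⟩ == b)
        (∏ j : Fin (k - 1), rootMass θ (child a j) (z a ⟨j + 1, by omega⟩)) 0 := by
  by_cases h : z a ⟨0, by omega⟩ = b
  · rw [beq_iff_eq.2 h, cond_true]
    refine Finset.prod_congr rfl fun j _ => ?_
    simp only [h, true_and]
    rfl
  · rw [beq_eq_false_iff_ne.2 h, cond_false]
    -- The condition on the root is repeated in every factor, so one child, available since `2 ≤ k`,
    -- makes the product vanish.
    refine Finset.prod_eq_zero (Finset.mem_univ (⟨0, by omega⟩ : Fin (k - 1))) ?_
    simp only [h, false_and, and_false]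
    exact mass_false

theorem rootMass_node (hk : 2 ≤ k) (θ : ℝ) (b : Bool) :
    rootMass θ (node n z child) b = ∏ a, (∏ j, mass θ (child a j) Config.Sat -
      cond (z a ⟨0, by omega⟩ == b)
        (∏ j : Fin (k - 1), rootMass θ (child a j) (z a ⟨j + 1, by omega⟩)) 0) := by
  have hj0 : Nonempty (Fin (k - 1)) := ⟨⟨0, by omega⟩⟩
  have key : ∀ u, (∑ t : ∀ a j, (child a j).Config, weight θ (join (z := z) (u, b) t) *
      ind ((join (z := z) (u, b) t).Sat)) = bitWeight θ u *
        ∏ a, (∏ j, mass θ (child a j) Config.Sat - cond (z a ⟨0, by omega⟩ == b)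
          (∏ j : Fin (k - 1), rootMass θ (child a j) (z a ⟨j + 1, by omega⟩)) 0) := by
    intro u
    simp only [← prod_mass_violating hk]
    rw [← sum_join (z := z) θ (u, b)]
    refine Finset.sum_congr rfl fun t _ => ?_
    congr 2
    rw [eq_iff_iff, sat_join (by omega)]
    simp only [forall_and, forall_const]
    constructor
    · rintro ⟨h1, h2⟩
      exact ⟨h2, fun a h => h1 a ⟨h.2.1, h.2.2⟩⟩
    · rintro ⟨h1, h2⟩
      exact ⟨fun a h => h2 a ⟨h1 a, h.1, h.2⟩, h1⟩
  rw [rootMass, mass_node, Fintype.sum_prod_type, Fintype.sum_bool]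
  have hr : ∀ (u c : Bool) (t : ∀ a j, (child a j).Config),
      ((join (z := z) (u, c) t).value (node n z child).root = b) = (c = b) := fun u c t => rfl
  simp only [hr]
  have hc : ∀ u, (∑ c : Bool, ∑ t : ∀ a j, (child a j).Config,
      weight θ (join (z := z) (u, c) t) * ind ((join (z := z) (u, c) t).Sat ∧ c = b)) =
      ∑ t : ∀ a j, (child a j).Config,
      weight θ (join (z := z) (u, b) t) * ind ((join (z := z) (u, b) t).Sat) := by
    intro u
    rw [Fintype.sum_eq_single b]
    · simp
    · intro c hcb
      simp [hcb, ind]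
  -- The root's membership in `U` does not affect satisfaction, and its two weights sum to `1`.
  rw [hc, hc, key, key, ← add_mul, bitWeight_add, one_mul]

theorem rootMass_sub_frozenMass (θ : ℝ) (T : Tree k) (b : Bool) :
    rootMass θ T b - frozenMass θ T b =
      mass θ T fun s => (s.Sat ∧ s.value T.root = b) ∧ ¬s.RootFrozen := by
  rw [rootMass, ← mass_add_mass_not θ T _ Config.RootFrozen, frozenMass]
  simp only [and_assoc, add_sub_cancel_left]

theorem prod_mass_implying (hk : 0 < k) (θ : ℝ) (b : Bool) (a : Fin n) :
    (∏ j : Fin (k - 1), mass θ (child a j) fun s => s.Sat ∧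
      (s.value (child a j).root = z a ⟨j + 1, by omega⟩ ∧ (z a ⟨0, hk⟩ = b ∨ s.RootFrozen))) =
      cond (z a ⟨0, hk⟩ == b)
        (∏ j : Fin (k - 1), rootMass θ (child a j) (z a ⟨j + 1, by omega⟩))
        (∏ j : Fin (k - 1), frozenMass θ (child a j) (z a ⟨j + 1, by omega⟩)) := by
  by_cases h : z a ⟨0, hk⟩ = b
  · rw [beq_iff_eq.2 h, cond_true]
    simp only [h, true_or, and_true]
    rfl
  · rw [beq_eq_false_iff_ne.2 h, cond_false]
    simp only [h, false_or]
    rfl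

/-- Either way the forbidden event has all children violating: if `b` violates the clause this alone
is excluded, otherwise they must moreover be frozen. -/
theorem sat_and_not_rootFrozen_join (hk : 0 < k) (u b : Bool) (t : ∀ a j, (child a j).Config) :
    ((join (z := z) (u, b) t).Sat ∧ ¬(join (z := z) (u, b) t).RootFrozen) ↔
      u = false ∧ ∀ a, (∀ j, (t a j).Sat) ∧ ¬∀ j : Fin (k - 1), (t a j).Sat ∧
        ((t a j).value (child a j).root = z a ⟨j + 1, by omega⟩ ∧
          (z a ⟨0, hk⟩ = b ∨ (t a j).RootFrozen)) := by
  constructor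
  · rintro ⟨hs, hf⟩
    rw [rootFrozen_join hk hs] at hf
    push Not at hf
    obtain ⟨h1, h2⟩ := (sat_join hk).1 hs
    refine ⟨by simpa using hf.1, fun a => ⟨h2 a, fun h => ?_⟩⟩
    by_cases hz : z a ⟨0, hk⟩ = b
    · exact h1 a ⟨hz, fun j => (h j).2.1⟩
    · obtain ⟨j, hj⟩ := hf.2 a
      exact hj (h j).2.1 ((h j).2.2.resolve_left hz)
  · rintro ⟨rfl, h⟩
    have hs : (join (z := z) (false, b) t).Sat := (sat_join hk).2
      ⟨fun a ha => (h a).2 fun j => ⟨(h a).1 j, ha.2 j, .inl ha.1⟩, fun a => (h a).1⟩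
    refine ⟨hs, ?_⟩
    rw [rootFrozen_join hk hs]
    rintro (h' | ⟨a, ha⟩)
    · simp at h'
    · exact (h a).2 fun j => ⟨(h a).1 j, (ha j).1, .inr (ha j).2⟩

theorem rootMass_sub_frozenMass_node (hk : 0 < k) (θ : ℝ) (b : Bool) :
    rootMass θ (node n z child) b - frozenMass θ (node n z child) b =
      (1 - θ) * ∏ a, (∏ j, mass θ (child a j) Config.Sat - cond (z a ⟨0, hk⟩ == b)
        (∏ j : Fin (k - 1), rootMass θ (child a j) (z a ⟨j + 1, by omega⟩))
        (∏ j : Fin (k - 1), frozenMass θ (child a j) (z a ⟨j + 1, by omega⟩))) := by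
  rw [rootMass_sub_frozenMass, mass_node]
  have hr : ∀ (r : Bool × Bool) (t : ∀ a j, (child a j).Config),
      ((join (z := z) r t).value (node n z child).root = b) = (r.2 = b) := fun r t => rfl
  simp only [hr]
  rw [Fintype.sum_eq_single (false, b)]
  · simp only [← prod_mass_implying hk]
    refine (Finset.sum_congr rfl fun t _ => ?_).trans (sum_join (z := z) θ (false, b) _)
    congr 2
    rw [eq_iff_iff, and_true, sat_and_not_rootFrozen_join hk, eq_self_iff_true, true_and]
  · rintro ⟨u, c⟩ hne
    refine Finset.sum_eq_zero fun t _ => ?_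
    rw [ind, if_neg, mul_zero]
    rintro ⟨⟨hs, rfl⟩, hf⟩
    exact hne (by rw [((sat_and_not_rootFrozen_join hk u c t).1 ⟨hs, hf⟩).1])

end Node

/-! ### The messages count solutions -/

/-- No sign condition on `θ` is needed, since the root weights sum to `1`. Each clause factor is
positive because a nonempty product of strictly smaller positive masses is subtracted. -/
theorem rootMass_pos (hk : 2 ≤ k) (θ : ℝ) (T : Tree k) : ∀ b, 0 < rootMass θ T b := by
  induction T with
  | node n z child ih =>
    intro b
    rw [rootMass_node hk]
    refine Finset.prod_pos fun a _ => ?_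
    have htot : ∀ j c, rootMass θ (child a j) c < mass θ (child a j) Config.Sat := by
      intro j c
      rw [mass_sat θ _ c]
      linarith [ih a j (!c)]
    rw [sub_pos]
    have hlt : ∏ j : Fin (k - 1), rootMass θ (child a j) (z a ⟨j + 1, by omega⟩) <
        ∏ j, mass θ (child a j) Config.Sat :=
      Finset.prod_lt_prod_of_nonempty (fun j _ => ih a j _) (fun j _ => htot j _)
        ⟨⟨0, by omega⟩, Finset.mem_univ _⟩
    cases z a ⟨0, by omega⟩ == b
    · exact Finset.prod_pos fun j _ => (ih a j false).trans (htot j false)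
    · exact hlt

theorem half_one_sub_tanh (x : ℝ) : (1 - Real.tanh x) / 2 = (1 + Real.exp (2 * x))⁻¹ := by
  rw [Real.tanh_eq_sinh_div_cosh, Real.sinh_eq, Real.cosh_eq, Real.exp_neg, two_mul, Real.exp_add]
  have := Real.exp_pos x
  field_simp
  ring

/-- The product is the probability that all other variables of the clause are violating. -/
theorem exp_two_mul_bpFun {m : ℕ} {h : Fin m → ℝ}
    (hq : ∏ i, ((1 - Real.tanh (h i)) / 2) < 1) :
    Real.exp (2 * bpFun h) = (1 - ∏ i, ((1 - Real.tanh (h i)) / 2))⁻¹ := by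
  have e : 1 / 2 ^ m * ∏ i, (1 - Real.tanh (h i)) = ∏ i, ((1 - Real.tanh (h i)) / 2) := by
    rw [Finset.prod_div_distrib, Finset.prod_const, Finset.card_univ, Fintype.card_fin]
    ring
  rw [bpFun, e, show ∀ y : ℝ, 2 * (-(1 / 2) * y) = -y by intro y; ring, Real.exp_neg,
    Real.exp_log (by linarith)]

/-- Both counts are products over the root clauses, so the ratios are computed clause by clause
after dividing by the unconstrained mass of the subtrees. -/
theorem message_spec (hk : 2 ≤ k) (θ : ℝ) (T : Tree k) : ∀ b,
    Real.exp (2 * (T.message θ b).1) = rootMass θ T (!b) / rootMass θ T b ∧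
      (T.message θ b).2 = frozenMass θ T b / rootMass θ T b := by
  induction T with
  | node n z child ih =>
    intro b
    have hk0 : 0 < k := by omega
    have hpos := fun a j => rootMass_pos hk θ (child a j)
    have htot : ∀ a j c, rootMass θ (child a j) c < mass θ (child a j) Config.Sat := by
      intro a j c
      rw [mass_sat θ _ c]
      linarith [hpos a j (!c)]
    have hmarg : ∀ a j c, (1 - Real.tanh ((child a j).message θ c).1) / 2 =
        rootMass θ (child a j) c / mass θ (child a j) Config.Sat := by
      intro a j c
      rw [half_one_sub_tanh, (ih a j c).1, mass_sat θ _ c]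
      have h1 := hpos a j c
      have h2 := hpos a j (!c)
      field_simp
    have hM : ∀ a, 0 < ∏ j, mass θ (child a j) Config.Sat := fun a =>
      Finset.prod_pos fun j _ => (hpos a j false).trans (htot a j false)
    have hlt : ∀ a, ∏ j : Fin (k - 1), rootMass θ (child a j) (z a ⟨j + 1, by omega⟩) <
        ∏ j, mass θ (child a j) Config.Sat := fun a =>
      Finset.prod_lt_prod_of_nonempty (fun j _ => hpos a j _) (fun j _ => htot a j _)
        ⟨⟨0, by omega⟩, Finset.mem_univ _⟩
    constructor
    · rw [rootMass_node hk, rootMass_node hk, ← Finset.prod_div_distrib]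
      simp only [message, aggregate, hk0, dite_true]
      rw [Finset.mul_sum, Real.exp_sum]
      refine Finset.prod_congr rfl fun a _ => ?_
      have hq : ∏ j : Fin (k - 1),
          ((1 - Real.tanh ((child a j).message θ (z a ⟨j + 1, by omega⟩)).1) / 2) =
          (∏ j : Fin (k - 1), rootMass θ (child a j) (z a ⟨j + 1, by omega⟩)) /
            ∏ j, mass θ (child a j) Config.Sat := by
        simp only [hmarg, Finset.prod_div_distrib]
      have he := exp_two_mul_bpFun
        (h := fun j : Fin (k - 1) => ((child a j).message θ (z a ⟨j + 1, by omega⟩)).1)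
        (by rw [hq, div_lt_one (hM a)]; exact hlt a)
      rw [hq] at he
      have hMa := (hM a).ne'
      have hsub := (sub_pos.2 (hlt a)).ne'
      -- The clause constrains the count for exactly one root value, so its factor is `exp (2 * u)`
      -- or the inverse.
      by_cases h : z a ⟨0, hk0⟩ = b
      · have h' : (z a ⟨0, hk0⟩ == !b) = false := by simp [h]
        rw [beq_iff_eq.2 h, h']
        simp only [cond_true, cond_false]
        rw [he]
        field_simp
        simp
      · have h' : (z a ⟨0, hk0⟩ == !b) = true := by simpa using Bool.eq_not.2 h
        rw [beq_eq_false_iff_ne.2 h, h']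
        simp only [cond_true, cond_false]
        rw [mul_neg, Real.exp_neg, he]
        field_simp
        simp
    · have hZ := (rootMass_pos hk θ (node n z child) b).ne'
      -- Only the unfrozen mass factors over clauses, so the complement is used.
      have hfro : frozenMass θ (node n z child) b = rootMass θ (node n z child) b -
          (rootMass θ (node n z child) b - frozenMass θ (node n z child) b) := by ring
      rw [hfro, sub_div, div_self hZ, rootMass_sub_frozenMass_node hk0, rootMass_node hk,
        mul_div_assoc, ← Finset.prod_div_distrib]
      simp only [message, aggregate, hk0, dite_true]
      congr 2
      refine Finset.prod_congr rfl fun a _ => ?_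
      have hMa := (hM a).ne'
      have hsub := (sub_pos.2 (hlt a)).ne'
      have hu : ∏ j : Fin (k - 1),
          ((1 - Real.tanh ((child a j).message θ (z a ⟨j + 1, by omega⟩)).1) / 2 *
            ((child a j).message θ (z a ⟨j + 1, by omega⟩)).2) =
          (∏ j : Fin (k - 1), frozenMass θ (child a j) (z a ⟨j + 1, by omega⟩)) /
            ∏ j, mass θ (child a j) Config.Sat := by
        rw [← Finset.prod_div_distrib]
        refine Finset.prod_congr rfl fun j _ => ?_
        rw [hmarg, (ih a j _).2]
        have := (hpos a j (z a ⟨j + 1, by omega⟩)).ne'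
        field_simp
      rw [hu]
      -- A clause violated by `b` cannot imply `b`: its factors cancel. Any other clause leaves `1 -
      -- û`.
      by_cases h : z a ⟨0, hk0⟩ = b
      · rw [beq_iff_eq.2 h]
        simp only [cond_true]
        rw [div_self hsub]
      · rw [beq_eq_false_iff_ne.2 h]
        simp only [cond_false, sub_zero]
        rw [sub_div, div_self hMa]

theorem sum_message (hk : 2 ≤ k) (θ : ℝ) (T : Tree k) :
    (∑ b : Bool, (1 - Real.tanh (T.message θ b).1) / 2 * (T.message θ b).2) =
      mass θ T (fun s => s.Sat ∧ s.RootFrozen) / mass θ T Config.Sat := by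
  have hterm : ∀ b, (1 - Real.tanh (T.message θ b).1) / 2 * (T.message θ b).2 =
      frozenMass θ T b / mass θ T Config.Sat := by
    intro b
    rw [half_one_sub_tanh, (message_spec hk θ T b).1, (message_spec hk θ T b).2, mass_sat θ T b]
    have h1 := rootMass_pos hk θ T b
    have h2 := rootMass_pos hk θ T (!b)
    field_simp
  rw [Fintype.sum_bool, hterm, hterm, ← add_div]
  congr 1
  rw [← mass_add_mass_not θ T _ fun s => s.value T.root = true]
  congr 1
  · exact mass_congr fun s => by tauto
  · exact mass_congr fun s => by rw [Bool.not_eq_true]; tauto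

/-! ### From weighted counts to probabilities -/

open Classical in
/-- A configuration consists of a set of fixed variables and an assignment. -/
noncomputable def configEquiv (T : Tree k) : T.Config ≃ Finset T.Var × (T.Var → Bool) where
  toFun s := (s.fixedSet, s.value)
  invFun p v := (decide (v ∈ p.1), p.2 v)
  left_inv s := by
    funext v
    refine Prod.ext ?_ rfl
    simp [Config.mem_fixedSet]
  right_inv p := by
    refine Prod.ext ?_ rfl
    ext v
    simp [Config.mem_fixedSet]

theorem subsetLaw_fixedSet (θ : ℝ≥0) (hθ : θ ≤ 1) {T : Tree k} (s : T.Config) :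
    subsetLaw θ hθ T.Var s.fixedSet = ENNReal.ofReal (weight θ s) := by
  have h1 : (0 : ℝ) ≤ 1 - θ := sub_nonneg.2 (by exact_mod_cast hθ)
  have hw : weight θ s =
      (θ : ℝ) ^ s.fixedSet.card * (1 - θ) ^ (Fintype.card T.Var - s.fixedSet.card) := by
    have : ∀ v, bitWeight (θ : ℝ) (s v).1 = if (s v).1 = true then (θ : ℝ) else 1 - θ := by
      intro v
      cases (s v).1 <;> simp [bitWeight]
    simp only [weight, this]
    rw [Finset.prod_ite, Finset.prod_const, Finset.prod_const, Config.fixedSet]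
    congr 2
    have := Finset.card_filter_add_card_filter_not (s := (Finset.univ : Finset T.Var))
      fun v => (s v).1 = true
    rw [Finset.card_univ] at this
    omega
  rw [subsetLaw, PMF.ofFintype_apply, hw, ENNReal.ofReal_mul (by positivity),
    ENNReal.ofReal_pow (by positivity), ENNReal.ofReal_pow h1, ENNReal.ofReal_sub 1 θ.coe_nonneg,
    ENNReal.ofReal_one, ENNReal.ofReal_coe_nnreal]

theorem weight_nonneg {θ : ℝ≥0} (hθ : θ ≤ 1) {T : Tree k} (s : T.Config) : 0 ≤ weight θ s := by
  refine Finset.prod_nonneg fun v _ => ?_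
  have h1 : (0 : ℝ) ≤ 1 - θ := sub_nonneg.2 (by exact_mod_cast hθ)
  cases (s v).1
  · exact h1
  · exact θ.2

theorem ind_nonneg (P : Prop) : 0 ≤ ind P := by
  unfold ind
  split_ifs <;> norm_num

theorem mass_nonneg {θ : ℝ≥0} (hθ : θ ≤ 1) (T : Tree k) (P : T.Config → Prop) :
    0 ≤ mass θ T P :=
  Finset.sum_nonneg fun s _ => mul_nonneg (weight_nonneg hθ s) (ind_nonneg _)

open Classical in
/-- The number of solutions. -/
noncomputable def solutionCount (T : Tree k) : ℕ :=
  (Finset.univ.filter T.formula.IsSolution).card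

theorem uniformSolution_apply (hk : 2 ≤ k) (T : Tree k) (x : T.Var → Bool) :
    T.formula.uniformSolution (T.exists_isSolution hk) x =
      ENNReal.ofReal (ind (T.formula.IsSolution x)) * (T.solutionCount : ℝ≥0∞)⁻¹ := by
  classical
  refine (PMF.uniformOfFinset_apply _ _).trans ?_
  rw [ind, solutionCount]
  simp only [Finset.mem_filter, Finset.mem_univ, true_and]
  split_ifs
  · rw [ENNReal.ofReal_one, one_mul]
  · rw [ENNReal.ofReal_zero, zero_mul]

/-- Being a solution does not involve `U`, whose weights sum to `1`. -/
theorem mass_sat_eq_solutionCount {θ : ℝ≥0} (hθ : θ ≤ 1) (T : Tree k) :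
    ENNReal.ofReal (mass θ T Config.Sat) = T.solutionCount := by
  classical
  rw [mass, ENNReal.ofReal_sum_of_nonneg fun s _ => mul_nonneg (weight_nonneg hθ s) (ind_nonneg _)]
  simp only [ENNReal.ofReal_mul (weight_nonneg hθ _), ← subsetLaw_fixedSet θ hθ]
  rw [← T.configEquiv.symm.sum_comp, Fintype.sum_prod_type]
  have h : ∀ (U : Finset T.Var) (x : T.Var → Bool),
      subsetLaw θ hθ T.Var (Config.fixedSet (T.configEquiv.symm (U, x))) *
        ENNReal.ofReal (ind (Config.Sat (T.configEquiv.symm (U, x)))) =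
      subsetLaw θ hθ T.Var U * ENNReal.ofReal (ind (T.formula.IsSolution x)) := by
    intro U x
    congr 2
    exact (Prod.ext_iff.1 (T.configEquiv.apply_symm_apply (U, x))).1
  simp only [h, ← Finset.mul_sum, ← Finset.sum_mul]
  rw [show ∑ U, subsetLaw θ hθ T.Var U = 1 from (tsum_fintype _).symm.trans (PMF.tsum_coe _),
    one_mul, solutionCount, Finset.card_filter, Nat.cast_sum]
  refine Finset.sum_congr rfl fun x _ => ?_
  rw [ind]
  split_ifs <;> simp

theorem frozen_probability (hk : 2 ≤ k) (θ : ℝ≥0) (hθ : θ ≤ 1) (T : Tree k) :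
    ((subsetLaw θ hθ T.Var).bind fun U =>
      (T.formula.uniformSolution (T.exists_isSolution hk)).bind fun x =>
        PMF.pure (⟨T, U, x⟩ : Σ T : Tree k, Finset T.Var × (T.Var → Bool))).toOuterMeasure
          (rootFrozen k) =
      ENNReal.ofReal (mass θ T (fun s => s.Sat ∧ s.RootFrozen) / mass θ T Config.Sat) := by
  classical
  have hpos : 0 < mass θ T Config.Sat := by
    rw [mass_sat _ _ true]
    exact add_pos (rootMass_pos hk _ _ _) (rootMass_pos hk _ _ _)
  rw [ENNReal.ofReal_div_of_pos hpos, mass_sat_eq_solutionCount hθ, mass,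
    ENNReal.ofReal_sum_of_nonneg fun s _ => mul_nonneg (weight_nonneg hθ s) (ind_nonneg _)]
  simp only [PMF.toOuterMeasure_bind_apply, PMF.toOuterMeasure_pure_apply, tsum_fintype]
  rw [div_eq_mul_inv, Finset.sum_mul, ← T.configEquiv.symm.sum_comp, Fintype.sum_prod_type]
  refine Finset.sum_congr rfl fun U _ => ?_
  rw [Finset.mul_sum]
  refine Finset.sum_congr rfl fun x _ => ?_
  have hU : Config.fixedSet (T.configEquiv.symm (U, x)) = U :=
    (Prod.ext_iff.1 (T.configEquiv.apply_symm_apply (U, x))).1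
  have hf : Config.RootFrozen (T.configEquiv.symm (U, x)) ↔
      (⟨T, U, x⟩ : Σ T : Tree k, Finset T.Var × (T.Var → Bool)) ∈ rootFrozen k := by
    rw [Config.RootFrozen, hU]
    rfl
  have hs : Config.Sat (T.configEquiv.symm (U, x)) ↔ T.formula.IsSolution x := Iff.rfl
  rw [ENNReal.ofReal_mul (weight_nonneg hθ _), ← subsetLaw_fixedSet θ hθ, hU,
    uniformSolution_apply hk, ind_and, ENNReal.ofReal_mul (ind_nonneg _), propext hf, propext hs,
    ← ENNReal.ofReal_one, ← ENNReal.ofReal_zero, ← apply_ite ENNReal.ofReal]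
  simp only [ind]
  split_ifs <;> ring

theorem message_snd_nonneg (hk : 2 ≤ k) {θ : ℝ≥0} (hθ : θ ≤ 1) (T : Tree k) (b : Bool) :
    0 ≤ (T.message θ b).2 := by
  rw [(message_spec hk θ T b).2]
  exact div_nonneg (mass_nonneg hθ _ _) (rootMass_pos hk _ _ _).le

end Tree

/-! ### Averaging over the random tree -/

theorem experiment_rootFrozen (k : ℕ) (hk : 2 ≤ k) (α θ : ℝ≥0) (hθ : θ ≤ 1) (ℓ : ℕ) :
    (experiment k hk α θ hθ ℓ).toOuterMeasure (rootFrozen k) =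
      2 * expect (hLaw k α θ hθ ℓ) fun p =>
        ENNReal.ofReal ((1 - Real.tanh p.1) / 2) * ENNReal.ofReal p.2 := by
  rw [experiment, PMF.toOuterMeasure_bind_apply]
  simp only [fun T : Tree k => (Tree.frozen_probability hk θ hθ T).trans
    (congrArg ENNReal.ofReal (Tree.sum_message hk θ T).symm)]
  have hT : ∀ T : Tree k,
      ENNReal.ofReal (∑ b : Bool, (1 - Real.tanh (T.message θ b).1) / 2 * (T.message θ b).2) =
        ENNReal.ofReal ((1 - Real.tanh (T.message θ true).1) / 2) *
          ENNReal.ofReal (T.message θ true).2 +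
        ENNReal.ofReal ((1 - Real.tanh (T.message θ false).1) / 2) *
          ENNReal.ofReal (T.message θ false).2 := by
    intro T
    have h := fun b => (half_one_sub_tanh_mem_Icc (T.message θ b).1).1
    rw [Fintype.sum_bool, ENNReal.ofReal_add (mul_nonneg (h _) (T.message_snd_nonneg hk hθ _))
      (mul_nonneg (h _) (T.message_snd_nonneg hk hθ _)), ENNReal.ofReal_mul (h _),
      ENNReal.ofReal_mul (h _)]
  simp only [hT]
  -- The integrand is a bounded function of `h` times `ĥ`, so the law with random `ζ` may be
  -- replaced by the one with constant `1 - θ`, which is the law of both messages.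
  rw [← expect, expect_add,
    (meanEq_hLaw k α θ hθ ℓ).2 (fun x => ENNReal.ofReal ((1 - Real.tanh x) / 2)) fun x =>
      ENNReal.ofReal_le_one.2 (half_one_sub_tanh_mem_Icc x).2]
  have hb := fun b => treeLaw_map_message k (by omega) α θ ℓ b
  rw [two_mul]
  congr 1
  · rw [← hb true, expect_map]
  · rw [← hb false, expect_map]

theorem toReal_expect_ofReal {A : Type} [MeasurableSpace A] [MeasurableSingletonClass A]
    (p : PMF A) {f : A → ℝ} (hf : Integrable f p.toMeasure) (h0 : ∀ a ∈ p.support, 0 ≤ f a) :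
    (expect p fun a => ENNReal.ofReal (f a)).toReal = ∫ a, f a ∂p.toMeasure := by
  rw [PMF.integral_eq_tsum p f hf, expect, ENNReal.tsum_toReal_eq]
  · refine tsum_congr fun a => ?_
    by_cases ha : a ∈ p.support
    · rw [ENNReal.toReal_mul, ENNReal.toReal_ofReal (h0 a ha), smul_eq_mul]
    · simp [(p.apply_eq_zero_iff a).2 ha]
  · exact fun a => ENNReal.mul_ne_top (p.apply_ne_top a) ENNReal.ofReal_ne_top

theorem ae_mem_support {A : Type} [MeasurableSpace A] [MeasurableSingletonClass A] (p : PMF A) :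
    ∀ᵐ a ∂p.toMeasure, a ∈ p.support := by
  have hm : MeasurableSet p.support := p.support_countable.measurableSet
  rw [ae_iff]
  exact (p.toMeasure_apply_eq_zero_iff hm.compl).2 (Set.disjoint_left.2 fun a ha hn => hn ha)

theorem integrable_one_sub_tanh_mul (k : ℕ) (α θ : ℝ≥0) (hθ : θ ≤ 1) (ℓ : ℕ) :
    Integrable (fun p : ℝ × ℝ => (1 - Real.tanh p.1) * p.2) (hLaw k α θ hθ ℓ).toMeasure := by
  refine Integrable.of_bound (C := 2) ?_ ?_
  · refine Measurable.aestronglyMeasurable ?_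
    have : Measurable Real.tanh := by
      simp only [funext Real.tanh_eq_sinh_div_cosh]
      exact Real.measurable_sinh.div Real.measurable_cosh
    fun_prop
  · filter_upwards [ae_mem_support (hLaw k α θ hθ ℓ)] with p hp
    have h1 := half_one_sub_tanh_mem_Icc p.1
    have h2 := sndInUnit_hLaw k α θ hθ ℓ p hp
    have h3 := mul_mem_Icc h1 h2
    rw [Real.norm_eq_abs, abs_le]
    constructor <;> nlinarith [h3.1, h3.2]

end KSatTree

theorem lemma4 (k : ℕ) (hk : 2 ≤ k) (α θ : ℝ≥0) (hθ : θ ≤ 1) (ℓ : ℕ) :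
    Integrable (fun p : ℝ × ℝ => (1 - Real.tanh p.1) * p.2)
        (KSatTree.hLaw k α θ hθ ℓ).toMeasure ∧
      ((KSatTree.experiment k hk α θ hθ ℓ).toOuterMeasure (KSatTree.rootFrozen k)).toReal =
        ∫ p : ℝ × ℝ, (1 - Real.tanh p.1) * p.2 ∂(KSatTree.hLaw k α θ hθ ℓ).toMeasure := by
  have hint := KSatTree.integrable_one_sub_tanh_mul k α θ hθ ℓ
  refine ⟨hint, ?_⟩
  rw [KSatTree.experiment_rootFrozen, ← KSatTree.toReal_expect_ofReal _ hint,
    ← KSatTree.expect_const_mul]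
  · congr 2
    funext p
    have h1 := (KSatTree.half_one_sub_tanh_mem_Icc p.1).1
    rw [← ENNReal.ofReal_mul h1, ← ENNReal.ofReal_ofNat 2, ← ENNReal.ofReal_mul (by norm_num)]
    congr 1
    ring
  · intro p hp
    have h1 := (KSatTree.half_one_sub_tanh_mem_Icc p.1).1
    exact mul_nonneg (by linarith) (KSatTree.sndInUnit_hLaw k α θ hθ ℓ p hp).1
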